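/- A closed trivalent graph $\Gamma$ determines a closed oriented surface $\Sigma_\Gamma$: take one trinion ($S^2$ minus three disjoint open discs) for every vertex of $\Gamma$, and for every edge glue the two corresponding boundary circles by an orientation-reversing homeomorphism. Every edge $e$ gives a simple closed curve $C_e\subset\Sigma_\Gamma$ (its meridian). Let $\operatorname{ClRep}(\pi_1(\Sigma_\Gamma))=\operatorname{Hom}(\pi_1(\Sigma_\Gamma),\operatorname{SU}(2))/\operatorname{SU}(2)$ be the space of conjugacy classes of $\operatorname{SU}(2)$-representations of the fundamental group, and let $$c_\Gamma=(c_{C_e})_{e\in E(\Gamma)}\colon \operatorname{ClRep}(\pi_1(\Sigma_\Gamma))\to\mathbb R^{E(\Gamma)},\qquad c_{C_e}(\rho)=\frac1\pi\cos^{-1}\Bigl(\frac12\operatorname{Tr}\rho([C_e])\Bigr)\in[0,1]$$ be the Goldman moment map, and $\Delta_\Gamma$ its image. Let $\Theta$ be the graph with two vertices joined by three edges, so that $\Sigma_\Theta$ has genus $2$. Let $3\Theta$ be the multi-theta graph of genus $3$: an oval crossed by two horizontal strings, with vertices $v_1,v_2$ (upper and lower) on the left side and their mirror images $i_0(v_1),i_0(v_2)$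 on the right side. Identify $\mathbb R^{E(3\Theta)}$ with $\mathbb R^3_1\times\mathbb R^3_2$, where $(t_1^1,t_2^1,t_3^1)$ are the coordinates of the three edges at $v_1$ (upper string, top arc, left arc $e_1$ joining $v_1$ to $v_2$) and $(t_1^2,t_2^2,t_3^2)$ are those of the three edges at $i_0(v_2)$ (lower string, bottom arc, right arc joining $i_0(v_1)$ to $i_0(v_2)$). Let $i_{e_1}\colon\mathbb R^6\to\mathbb R^6$ be the involution that interchanges $t_3^1$ and $t_3^2$ and fixes the other coordinates. **Theorem.** $\Delta_\Theta\subset\mathbb R^3$ is the tetrahedron with vertices $(0,0,0),(0,1,1),(1,0,1),(1,1,0)$, and $$\Delta_{3\Theta}=(\Delta_\Theta\times\Delta_\Theta)\cap i_{e_1}(\Delta_\Theta\times\Delta_\Theta)\subset\mathbb R^6 .$$ -/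

import Mathlib

noncomputable section

/-! ### The trinion: a round 2-sphere with three disjoint open discs deleted -/

/-- The centres of the three deleted discs, all lying on the equator. -/
def trinionCenter : Fin 3 → EuclideanSpace ℝ (Fin 3) :=
  ![!₂[1, 0, 0], !₂[0, 1, 0], !₂[-1, 0, 0]]

/-- The unit tangent vectors of the (counterclockwise) equator at the three centres. -/
def trinionTangent : Fin 3 → EuclideanSpace ℝ (Fin 3) :=
  ![!₂[0, 1, 0], !₂[-1, 0, 0], !₂[0, -1, 0]]

/-- The north pole. -/
def northPole : EuclideanSpace ℝ (Fin 3) := !₂[0, 0, 1]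

/-- The trinion: the unit sphere `S²` minus the three disjoint open spherical discs
`{x | 4/5 < ⟪c, x⟫}` around the three centres `c`. -/
def Trinion : Type :=
  {x : EuclideanSpace ℝ (Fin 3) //
    x ∈ Metric.sphere (0 : EuclideanSpace ℝ (Fin 3)) 1 ∧
      ∀ k, inner ℝ (trinionCenter k) x ≤ 4 / 5}

instance : TopologicalSpace Trinion := by unfold Trinion; infer_instance

/-- The point with parameter `z` of the `k`-th boundary circle, which is the circle
`{x ∈ S² | ⟪c, x⟫ = 4/5}` of radius `3/5` about the centre `c`. -/
def boundaryPoint (k : Fin 3) (z : Circle) : EuclideanSpace ℝ (Fin 3) :=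
  (4 / 5 : ℝ) • trinionCenter k + (3 / 5 * (z : ℂ).re) • trinionTangent k
    + (3 / 5 * (z : ℂ).im) • northPole

theorem circle_re_im (z : Circle) : (z : ℂ).re ^ 2 + (z : ℂ).im ^ 2 = 1 := by
  have h := Circle.normSq_coe z
  rw [Complex.normSq_apply] at h
  nlinarith

theorem boundaryPoint_mem (k : Fin 3) (z : Circle) :
    boundaryPoint k z ∈ Metric.sphere (0 : EuclideanSpace ℝ (Fin 3)) 1 ∧
      ∀ j, inner ℝ (trinionCenter j) (boundaryPoint k z) ≤ 4 / 5 := by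
  have hz := circle_re_im z
  have h1 : (z : ℂ).re ≤ 1 := by nlinarith [sq_nonneg (z : ℂ).im]
  have h2 : -1 ≤ (z : ℂ).re := by nlinarith [sq_nonneg (z : ℂ).im]
  constructor
  · rw [mem_sphere_zero_iff_norm, EuclideanSpace.norm_eq, Real.sqrt_eq_one]
    fin_cases k <;>
      simp [boundaryPoint, trinionCenter, trinionTangent, northPole, Fin.sum_univ_three] <;>
      nlinarith
  · intro j
    fin_cases k <;> fin_cases j <;>
      simp [boundaryPoint, trinionCenter, trinionTangent, northPole, PiLp.inner_apply,
        Fin.sum_univ_three] <;>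
      linarith

/-- The parametrised `k`-th boundary circle of the trinion. The three parametrisations induce the
same (boundary) orientation: they differ by rotations of the sphere about the vertical axis. -/
def trinionBoundary (k : Fin 3) (z : Circle) : Trinion :=
  ⟨boundaryPoint k z, boundaryPoint_mem k z⟩

theorem continuous_trinionBoundary (k : Fin 3) : Continuous (trinionBoundary k) := by
  refine Continuous.subtype_mk ?_ _
  unfold boundaryPoint
  have h : Continuous fun z : Circle => (z : ℂ) := continuous_subtype_val
  have h1 := Complex.continuous_re.comp h
  have h2 := Complex.continuous_im.comp h
  exact (continuous_const.add ((continuous_const.mul h1).smul continuous_const)).add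
    ((continuous_const.mul h2).smul continuous_const)

/-! ### Trivalent graphs and the surfaces obtained by pumping them up -/

/-- A closed trivalent graph (loops and multiple edges allowed) with vertex set `V`: every vertex
`v` has three half-edges `(v, 0)`, `(v, 1)`, `(v, 2)`, and an edge is a pair `{h, opp h}` of
half-edges. -/
structure TrivalentGraph (V : Type) where
  /-- The other half of the edge to which a half-edge belongs. -/
  opp : V × Fin 3 → V × Fin 3
  opp_opp : ∀ h, opp (opp h) = h
  opp_ne : ∀ h, opp h ≠ h

namespace TrivalentGraph

variable {V : Type} (Γ : TrivalentGraph V)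

/-- The two boundary circles belonging to the two halves of an edge are glued by the
orientation reversing map `z ↦ z⁻¹`. -/
inductive Glue : (_ : V) × Trinion → (_ : V) × Trinion → Prop
  | glue (h : V × Fin 3) (z : Circle) :
      Glue ⟨h.1, trinionBoundary h.2 z⟩ ⟨(Γ.opp h).1, trinionBoundary (Γ.opp h).2 z⁻¹⟩

/-- The closed surface `Σ_Γ`: one trinion for every vertex, glued along the boundary circles
according to the edges, with the quotient topology. -/
def Surface : Type := Quot Γ.Glue

instance : TopologicalSpace Γ.Surface := by unfold Surface; infer_instance

/-- The trinion of the vertex `v` in `Σ_Γ`. -/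
def trinion (v : V) (p : Trinion) : Γ.Surface := Quot.mk _ ⟨v, p⟩

theorem continuous_trinion (v : V) : Continuous (Γ.trinion v) :=
  continuous_quot_mk.comp continuous_sigmaMk

/-- The meridian circle `C_e` of the edge `e = {h, opp h}`, as the closed path in `Σ_Γ` running
once around the boundary circle `h`. (The one of `opp h` is the same path reversed.) -/
def meridian (h : V × Fin 3) :
    Path (Γ.trinion h.1 (trinionBoundary h.2 1)) (Γ.trinion h.1 (trinionBoundary h.2 1)) where
  toFun t := Γ.trinion h.1 (trinionBoundary h.2 (Circle.exp (2 * Real.pi * (t : ℝ))))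
  continuous_toFun := (Γ.continuous_trinion h.1).comp <|
    (continuous_trinionBoundary h.2).comp <| Circle.exp.continuous.comp <|
      continuous_const.mul continuous_subtype_val
  source' := by simp
  target' := by simp

end TrivalentGraph

/-! ### Path connectedness of the surfaces -/

/-- The image of the trinion under the vertical projection. -/
def trinionShadow : Set (ℝ × ℝ) :=
  {y | y.1 ^ 2 + y.2 ^ 2 ≤ 1 ∧ y.1 ≤ 4 / 5 ∧ y.2 ≤ 4 / 5 ∧ -y.1 ≤ 4 / 5}

theorem convex_trinionShadow : Convex ℝ trinionShadow := by
  intro a ha b hb s t hs ht hst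
  obtain ⟨ha0, ha1, ha2, ha3⟩ := ha
  obtain ⟨hb0, hb1, hb2, hb3⟩ := hb
  have ht' : t = 1 - s := by linarith
  subst ht'
  refine ⟨?_, ?_, ?_, ?_⟩ <;> simp only [Prod.fst_add, Prod.snd_add, Prod.smul_fst, Prod.smul_snd,
    smul_eq_mul]
  · nlinarith [mul_nonneg hs ht, mul_nonneg (mul_nonneg hs ht) (sq_nonneg (a.1 - b.1)),
      mul_nonneg (mul_nonneg hs ht) (sq_nonneg (a.2 - b.2))]
  · nlinarith
  · nlinarith
  · nlinarith

/-- The point over `y` in the upper (`ε = 1`) or lower (`ε = -1`) half of the trinion. -/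
def trinionLift (ε : ℝ) (y : ℝ × ℝ) : EuclideanSpace ℝ (Fin 3) :=
  !₂[y.1, y.2, ε * √(1 - y.1 ^ 2 - y.2 ^ 2)]

theorem trinionLift_mem (ε : ℝ) (hε : ε ^ 2 = 1) (y : ℝ × ℝ) (hy : y ∈ trinionShadow) :
    trinionLift ε y ∈ Metric.sphere (0 : EuclideanSpace ℝ (Fin 3)) 1 ∧
      ∀ j, inner ℝ (trinionCenter j) (trinionLift ε y) ≤ 4 / 5 := by
  obtain ⟨h0, h1, h2, h3⟩ := hy
  constructor
  · rw [mem_sphere_zero_iff_norm, EuclideanSpace.norm_eq, Real.sqrt_eq_one]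
    have hs := Real.sq_sqrt (show 0 ≤ 1 - y.1 ^ 2 - y.2 ^ 2 by linarith)
    simp [trinionLift, Fin.sum_univ_three, mul_pow, hε, hs]
  · intro j
    fin_cases j <;>
      simp [trinionLift, trinionCenter, PiLp.inner_apply, Fin.sum_univ_three] <;>
      linarith

theorem isPathConnected_half (ε : ℝ) :
    IsPathConnected (trinionLift ε '' trinionShadow) := by
  refine (convex_trinionShadow.isPathConnected ⟨(0, 0), ?_⟩).image ?_
  · norm_num [trinionShadow]
  · unfold trinionLift
    fun_prop

instance : PathConnectedSpace Trinion := by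
  have hU : IsPathConnected ((trinionLift 1 '' trinionShadow) ∪
      (trinionLift (-1) '' trinionShadow)) := by
    refine (isPathConnected_half 1).union (isPathConnected_half (-1))
      ⟨trinionLift 1 (0, -1), ⟨_, ?_, rfl⟩, ⟨(0, -1), ?_, ?_⟩⟩
    · norm_num [trinionShadow]
    · norm_num [trinionShadow]
    · norm_num [trinionLift]
  have hS : {x : EuclideanSpace ℝ (Fin 3) |
      x ∈ Metric.sphere (0 : EuclideanSpace ℝ (Fin 3)) 1 ∧
      ∀ k, inner ℝ (trinionCenter k) x ≤ 4 / 5} =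
      ((trinionLift 1 '' trinionShadow) ∪ (trinionLift (-1) '' trinionShadow)) := by
    ext x
    constructor
    · rintro ⟨hx, hk⟩
      rw [mem_sphere_zero_iff_norm, EuclideanSpace.norm_eq, Real.sqrt_eq_one] at hx
      simp only [Fin.sum_univ_three, Real.norm_eq_abs, sq_abs] at hx
      have h0 := hk 0
      have h1 := hk 1
      have h2 := hk 2
      simp [trinionCenter, PiLp.inner_apply, Fin.sum_univ_three] at h0 h1 h2
      have hm : (x 0, x 1) ∈ trinionShadow :=
        ⟨by nlinarith [sq_nonneg (x 2)], h0, h1, by simpa using h2⟩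
      have he : 1 - x 0 ^ 2 - x 1 ^ 2 = x 2 ^ 2 := by linarith
      rcases le_total 0 (x 2) with h | h
      · refine Or.inl ⟨_, hm, ?_⟩
        ext i
        fin_cases i <;> simp [trinionLift, he, Real.sqrt_sq_eq_abs, abs_of_nonneg h]
      · refine Or.inr ⟨_, hm, ?_⟩
        ext i
        fin_cases i <;> simp [trinionLift, he, Real.sqrt_sq_eq_abs, abs_of_nonpos h]
    · rintro (⟨y, hy, rfl⟩ | ⟨y, hy, rfl⟩)
      · exact trinionLift_mem 1 (by norm_num) y hy
      · exact trinionLift_mem (-1) (by norm_num) y hy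
  rw [← hS] at hU
  exact isPathConnected_iff_pathConnectedSpace.mp hU

namespace TrivalentGraph

variable {V : Type} (Γ : TrivalentGraph V)

theorem joined_trinion (v : V) (p q : Trinion) : Joined (Γ.trinion v p) (Γ.trinion v q) :=
  ⟨(PathConnectedSpace.somePath p q).map (Γ.continuous_trinion v)⟩

theorem joined_opp (h : V × Fin 3) (p q : Trinion) :
    Joined (Γ.trinion h.1 p) (Γ.trinion (Γ.opp h).1 q) := by
  have e : Γ.trinion h.1 (trinionBoundary h.2 1)
      = Γ.trinion (Γ.opp h).1 (trinionBoundary (Γ.opp h).2 1⁻¹) :=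
    Quot.sound (Glue.glue h 1)
  refine (Γ.joined_trinion h.1 p (trinionBoundary h.2 1)).trans ?_
  rw [e]
  exact Γ.joined_trinion _ _ _

theorem pathConnectedSpace_surface (v₀ : V)
    (H : ∀ v, Relation.ReflTransGen (fun a b => ∃ k, (Γ.opp (a, k)).1 = b) v₀ v) :
    PathConnectedSpace Γ.Surface := by
  have key : ∀ v, ∀ p q : Trinion, Joined (Γ.trinion v₀ p) (Γ.trinion v q) := by
    intro v
    induction H v with
    | refl => exact fun p q => Γ.joined_trinion v₀ p q
    | tail _ h ih =>
      obtain ⟨k, rfl⟩ := h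
      exact fun p q => (ih p p).trans (Γ.joined_opp (_, k) p q)
  refine ⟨⟨Γ.trinion v₀ (trinionBoundary 0 1)⟩, ?_⟩
  rintro ⟨v, p⟩ ⟨w, q⟩
  exact (key v p p).symm.trans (key w p q)

end TrivalentGraph

/-! ### Representation classes and Goldman functions -/

/-- The group `SU(2)`. -/
abbrev SU2 : Type := Matrix.specialUnitaryGroup (Fin 2) ℂ

/-- Two `SU(2)`-representations are equivalent if they are conjugate by an element of `SU(2)`. -/
def repSetoid (π : Type) [Group π] : Setoid (π →* SU2) where
  r ρ σ := ∃ g : SU2, ∀ a, σ a = g * ρ a * g⁻¹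
  iseqv :=
    { refl := fun ρ => ⟨1, fun a => by simp⟩
      symm := fun {ρ σ} ⟨g, h⟩ => ⟨g⁻¹, fun a => by rw [h a]; group⟩
      trans := fun {ρ σ τ} ⟨g, h⟩ ⟨k, h'⟩ => ⟨k * g, fun a => by rw [h' a, h a]; group⟩ }

/-- The space of classes of `SU(2)`-representations of a group. -/
def ClRep (π : Type) [Group π] : Type := Quotient (repSetoid π)

/-- `(1/π) · arccos (tr A / 2)`, for `A ∈ SU(2)` (whose trace is real, in `[-2, 2]`). -/
def su2Angle (A : SU2) : ℝ :=
  1 / Real.pi * Real.arccos (1 / 2 * (Matrix.trace (A : Matrix (Fin 2) (Fin 2) ℂ)).re)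

theorem su2Angle_conj (g A : SU2) : su2Angle (g * A * g⁻¹) = su2Angle A := by
  have h : ((g⁻¹ : SU2) : Matrix (Fin 2) (Fin 2) ℂ) * (g : Matrix (Fin 2) (Fin 2) ℂ) = 1 := by
    exact congrArg Subtype.val (inv_mul_cancel g)
  have h2 : ((g * A * g⁻¹ : SU2) : Matrix (Fin 2) (Fin 2) ℂ)
      = (g : Matrix (Fin 2) (Fin 2) ℂ) * A * ((g⁻¹ : SU2) : Matrix (Fin 2) (Fin 2) ℂ) := rfl
  unfold su2Angle
  rw [h2, Matrix.trace_mul_comm, ← Matrix.mul_assoc, h, Matrix.one_mul]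

/-- The element of `π₁(X, x)` given by a closed path `C` based at `p` and a path `γ` from `x`
to `p`. -/
def loopClassAlong {X : Type} [TopologicalSpace X] {x p : X} (γ : Path x p) (C : Path p p) :
    FundamentalGroup X x :=
  FundamentalGroup.fromPath (Path.Homotopic.Quotient.mk ((γ.trans C).trans γ.symm))

/-- The class of a closed path `C` in `π₁(X, x)`, well defined up to conjugation. -/
def loopClass {X : Type} [TopologicalSpace X] [PathConnectedSpace X] (x : X) {p : X}
    (C : Path p p) : FundamentalGroup X x :=
  loopClassAlong (PathConnectedSpace.somePath x p) C

/-- The Goldman function of a closed path `C`: it sends the class of `ρ` to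
`(1/π) · arccos (tr ρ([C]) / 2)`. -/
def goldman {X : Type} [TopologicalSpace X] [PathConnectedSpace X] (x : X) {p : X}
    (C : Path p p) : ClRep (FundamentalGroup X x) → ℝ :=
  Quotient.lift (fun ρ => su2Angle (ρ (loopClass x C))) (by
    rintro ρ σ ⟨g, h⟩
    rw [h, su2Angle_conj])

open CategoryTheory in
/-- The value of the Goldman function does not depend on the path that connects the base point
to the closed path. -/
theorem goldman_mk {X : Type} [TopologicalSpace X] [PathConnectedSpace X] (x : X) {p : X}
    (C : Path p p) (γ : Path x p) (ρ : FundamentalGroup X x →* SU2) :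
    goldman x C (Quotient.mk _ ρ) = su2Angle (ρ (loopClassAlong γ C)) := by
  change su2Angle (ρ (loopClassAlong (PathConnectedSpace.somePath x p) C)) = _
  set δ := PathConnectedSpace.somePath x p
  set c : FundamentalGroup X x :=
    FundamentalGroup.fromPath (Path.Homotopic.Quotient.mk (γ.trans δ.symm))
  have hc : loopClassAlong δ C = c * loopClassAlong γ C * c⁻¹ := by
    let a : FundamentalGroupoid.mk x ⟶ FundamentalGroupoid.mk p := Path.Homotopic.Quotient.mk δ
    let b : FundamentalGroupoid.mk x ⟶ FundamentalGroupoid.mk p := Path.Homotopic.Quotient.mk γ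
    let l : FundamentalGroupoid.mk p ⟶ FundamentalGroupoid.mk p := Path.Homotopic.Quotient.mk C
    change (a ≫ l) ≫ Groupoid.inv a =
      Groupoid.inv (b ≫ Groupoid.inv a) ≫
        ((b ≫ l) ≫ Groupoid.inv b) ≫ (b ≫ Groupoid.inv a)
    simp [Groupoid.inv_eq_inv]
  rw [hc, map_mul, map_mul, map_inv, su2Angle_conj]

/-! ### The graphs `Θ` and `3Θ` and their moment maps -/

/-- The graph `Θ`: two vertices joined by three edges. -/
def thetaGraph : TrivalentGraph Bool where
  opp h := (!h.1, h.2)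
  opp_opp := by decide
  opp_ne := by decide

/-- The multi-theta graph `3Θ`: an oval crossed by two horizontal strings. The vertex `(i, s)` is
the end of the `i`-th string (`0` is the upper and `1` the lower one) on the left (`s = false`) or
on the right (`s = true`) side of the oval. Half-edge `0` belongs to the string, half-edge `1` to
the arc of the oval that closes it at the top (`i = 0`) or at the bottom (`i = 1`), and half-edge
`2` to the arc on the left or on the right side of the oval, between the two strings. -/
def threeThetaGraph : TrivalentGraph (Fin 2 × Bool) where
  opp h := if h.2 = 2 then ((1 - h.1.1, h.1.2), 2) else ((h.1.1, !h.1.2), h.2)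
  opp_opp := by decide
  opp_ne := by decide

instance : PathConnectedSpace thetaGraph.Surface := by
  refine thetaGraph.pathConnectedSpace_surface false fun v => ?_
  cases v
  · exact .refl
  · exact .single ⟨0, rfl⟩

instance : PathConnectedSpace threeThetaGraph.Surface := by
  refine threeThetaGraph.pathConnectedSpace_surface (0, false) fun v => ?_
  obtain ⟨i, s⟩ := v
  have h1 : Relation.ReflTransGen (fun a b => ∃ k, (threeThetaGraph.opp (a, k)).1 = b)
      (0, false) (i, false) := by
    fin_cases i
    · exact .refl
    · exact .single ⟨2, rfl⟩
  cases s
  · exact h1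
  · exact h1.tail ⟨0, by simp [threeThetaGraph]⟩

/-- The moment map `c_Θ` on the representation classes of the genus 2 surface `Σ_Θ`: the Goldman
functions of the meridians of the three edges. -/
def momentMapTheta (x : thetaGraph.Surface) :
    ClRep (FundamentalGroup thetaGraph.Surface x) → (Fin 3 → ℝ) :=
  fun ρ k => goldman x (thetaGraph.meridian (false, k)) ρ

/-- The moment map `c_{3Θ}` on the representation classes of the genus 3 surface `Σ_{3Θ}`: the
Goldman functions of the meridians of the six edges. The six edges are the three edges at the
vertex `v₁` (upper left), giving the coordinates `t₁¹, t₂¹, t₃¹` of the first `ℝ³`, and the three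
edges at the vertex `i₀(v₂)` (lower right), giving the coordinates `t₁², t₂², t₃²` of the second.
In particular `t₃¹` belongs to the left side `e₁` of the oval and `t₃²` to the right side. -/
def momentMapThreeTheta (x : threeThetaGraph.Surface) :
    ClRep (FundamentalGroup threeThetaGraph.Surface x) → (Fin 3 → ℝ) × (Fin 3 → ℝ) :=
  fun ρ => (fun k => goldman x (threeThetaGraph.meridian ((0, false), k)) ρ,
    fun k => goldman x (threeThetaGraph.meridian ((1, true), k)) ρ)

/-- The tetrahedron `Δ_Θ`. -/
def tetrahedron : Set (Fin 3 → ℝ) :=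
  convexHull ℝ {![0, 0, 0], ![0, 1, 1], ![1, 0, 1], ![1, 1, 0]}

/-- The involution `i_{e₁}` of `ℝ³ × ℝ³` interchanging the coordinates `t₃¹` and `t₃²`. -/
def swapThird (t : (Fin 3 → ℝ) × (Fin 3 → ℝ)) : (Fin 3 → ℝ) × (Fin 3 → ℝ) :=
  (![t.1 0, t.1 1, t.2 2], ![t.2 0, t.2 1, t.1 2])

end

/-! Cut each trinion along the equator into two closed halves. The vertical projection identifies
each half with a convex plane region, so each half is contractible. The equator meets the trinion in
three arcs, and every boundary circle consists of one upper and one lower semicircle.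

Necessity. Over each half the holonomy of a representation has a potential, `U` above and `L` below,
and `U * L⁻¹` is constant along each equatorial arc. This gives three group elements `d 0`, `d 1`,
`d 2`, and the meridian of circle `k` has holonomy conjugate to `d (k + 2) * (d k)⁻¹`
(`exists_holonomy_meridian`). In `SU(2) = S³` the normalised angle of `A * B⁻¹` is the spherical
distance of `A` and `B` divided by `π`, so the three meridian angles at a vertex are the sides of a
spherical triangle. The triangle inequalities, together with the bound `2π` on the perimeter, are
exactly the four faces of the tetrahedron (`mem_tetrahedron_iff`, `su2Angle_mem_tetrahedron`).

Sufficiency. The spherical law of cosines realises every point of the tetrahedron by a triangle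
(`exists_su2Angle_eq`). When two vertices prescribe the same value on a common edge, the two
meridian holonomies have equal trace, hence are conjugate, and a conjugating element serves as
transition across the edge (`exists_gluingData`). Such locally constant transitions between the half
trinions are turned into a representation without a presentation of the fundamental group. At each
point of the surface one records the partial function that assigns to every half containing the
point its frame, up to left multiplication. Since the halves are closed, a nearby point sees a
restriction of this function; so the record is a continuous map to a quotient space over which
partial frames form a covering with group `G`. Its monodromy is the representation
(`exists_representation`).

So the image consists of the edge labellings whose triple at every vertex lies in the tetrahedron.
For `Θ` the two vertices carry the same triple. For `3Θ` two of the four vertices give the product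
of tetrahedra, and the other two give its image under the swap. -/

/-! ### Partial frames and their covering space -/

/-- Nonempty partial functions on `F` with values in `G`. -/
@[ext]
structure PartialFrame (F G : Type) where
  /-- The partial function. -/
  toFun : F → Option G
  exists_eq_some : ∃ f a, toFun f = some a

namespace PartialFrame

variable {F G : Type}

/-- `φ ≤ ψ` if `ψ` is a restriction of `φ`. -/
instance : Preorder (PartialFrame F G) where
  le φ ψ := ∀ f a, ψ.toFun f = some a → φ.toFun f = some a
  le_refl _ _ _ h := h
  le_trans _ _ _ h h' f a hf := h f a (h' f a hf)

instance : TopologicalSpace (PartialFrame F G) := Topology.upperSet _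

instance : Topology.IsUpperSet (PartialFrame F G) := ⟨rfl⟩

variable [Group G]

instance : MulAction G (PartialFrame F G) where
  smul g φ := ⟨fun f => (φ.toFun f).map (g * ·), by
    obtain ⟨f, a, h⟩ := φ.exists_eq_some
    exact ⟨f, g * a, by simp [h]⟩⟩
  one_smul φ := by
    ext1
    funext f
    change (φ.toFun f).map (1 * ·) = φ.toFun f
    simp
  mul_smul g h φ := by
    ext1
    funext f
    change (φ.toFun f).map (g * h * ·) = ((φ.toFun f).map (h * ·)).map (g * ·)
    simp [Function.comp_def, mul_assoc]

theorem smul_toFun (g : G) (φ : PartialFrame F G) (f : F) :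
    (g • φ).toFun f = (φ.toFun f).map (g * ·) := rfl

theorem smul_le_smul {φ ψ : PartialFrame F G} (g : G) (h : φ ≤ ψ) : g • φ ≤ g • ψ := by
  intro f a hf
  rw [smul_toFun, Option.map_eq_some_iff] at hf ⊢
  obtain ⟨b, hb, rfl⟩ := hf
  exact ⟨b, h f b hb, rfl⟩

variable (F G) in
/-- The space of partial frames up to left multiplication. -/
abbrev Class : Type := Quotient (MulAction.orbitRel G (PartialFrame F G))

/-- The class of a partial frame. -/
def toClass (φ : PartialFrame F G) : Class F G := Quotient.mk _ φ

theorem toClass_eq_iff {φ ψ : PartialFrame F G} : φ.toClass = ψ.toClass ↔ ∃ g : G, g • ψ = φ := by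
  rw [toClass, toClass, Quotient.eq, MulAction.orbitRel_apply]
  rfl

/-- The set of restrictions of `φ` is the smallest neighbourhood of `φ`. If it contains both `ψ` and
`g • ψ`, then both agree with `φ` at a point of the nonempty domain of `ψ`, which forces `g = 1`. -/
theorem isQuotientCoveringMap_toClass :
    IsQuotientCoveringMap (toClass : PartialFrame F G → Class F G) G where
  toIsQuotientMap := isQuotientMap_quotient_mk'
  continuous_const_smul g := Topology.IsUpperSet.monotone_iff_continuous.mp
    fun _ _ h => smul_le_smul g h
  apply_eq_iff_mem_orbit := toClass_eq_iff
  disjoint φ := by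
    refine ⟨Set.Ici φ, by simp [Topology.IsUpperSet.nhds_eq_principal_Ici], ?_⟩
    rintro g ⟨_, ⟨ψ, hψ, rfl⟩, hgψ⟩
    obtain ⟨f, a, h⟩ := ψ.exists_eq_some
    have h1 := hψ f a h
    have h2 := hgψ f (g * a) (by simp [smul_toFun, h])
    simpa [h1] using h2

/-- A map to the classes of partial frames is continuous if near every point it is represented
by restrictions. -/
theorem continuous_toClass_comp {Y : Type} [TopologicalSpace Y] (c : Y → PartialFrame F G)
    (hc : ∀ y, ∀ᶠ y' in nhds y, ∃ g : G, c y ≤ g • c y') :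
    Continuous fun y => (c y).toClass := by
  rw [continuous_iff_continuousAt]
  intro y
  rw [ContinuousAt, tendsto_nhds]
  intro U hU hy
  have hU' : IsUpperSet (toClass ⁻¹' U) :=
    Topology.IsUpperSet.isOpen_iff_isUpperSet.mp
      (hU.preimage (isQuotientCoveringMap_toClass (F := F) (G := G)).continuous)
  filter_upwards [hc y] with y' ⟨g, hg⟩
  have h1 : (g • c y').toClass ∈ U := hU' hg hy
  rwa [isQuotientCoveringMap_toClass.map_smul] at h1

/-- If the frames `c y` are all defined at `f`, then normalising their values at `f` gives a
continuous family. -/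
theorem continuous_normalize {Y : Type} [TopologicalSpace Y] (c : Y → PartialFrame F G)
    (hc : ∀ y, ∀ᶠ y' in nhds y, ∃ g : G, c y ≤ g • c y') (f : F) (a : Y → G)
    (ha : ∀ y, (c y).toFun f = some (a y)) :
    Continuous fun y => (a y)⁻¹ • c y := by
  rw [continuous_iff_continuousAt]
  intro y
  rw [ContinuousAt, Topology.IsUpperSet.nhds_eq_principal_Ici ((a y)⁻¹ • c y),
    Filter.tendsto_principal]
  filter_upwards [hc y] with y' ⟨g, hg⟩
  -- Comparing values at `f` determines `g`, so after normalisation the restriction relation holds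
  -- without a translation.
  have h1 := hg f (g * a y') (by simp [smul_toFun, ha])
  rw [ha, Option.some_inj] at h1
  have h2 := smul_le_smul (a y)⁻¹ hg
  rwa [smul_smul, show (a y)⁻¹ * g = (a y')⁻¹ by rw [h1]; group] at h2

end PartialFrame

/-! ### Holonomy of quotient coverings -/

namespace IsCoveringMap

variable {E X : Type} [TopologicalSpace E] [TopologicalSpace X] {p : E → X} (cov : IsCoveringMap p)

theorem monodromy_mk_eq {x y : X} (γ : Path x y) (L : unitInterval → E) (hL : Continuous L)
    (h : ∀ t, p (L t) = γ t) (e : p ⁻¹' {x}) (he : (e : E) = L 0) :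
    (cov.monodromy (Path.Homotopic.Quotient.mk γ) e : E) = L 1 := by
  have h1 := (cov.eq_liftPath_iff (γ := γ) (e := e) (γ_0 := γ.source.trans e.2.symm) (Γ := L)).mpr
    ⟨hL, funext h, he.symm⟩
  exact congrFun h1.symm 1

end IsCoveringMap

namespace IsQuotientCoveringMap

variable {E X G : Type} [TopologicalSpace E] [TopologicalSpace X] [Group G] [MulAction G E]
  {p : E → X} (hp : IsQuotientCoveringMap p G)

theorem monodromy_smul {x y : X} (γ : Path.Homotopic.Quotient x y) (e e' : p ⁻¹' {x}) (g : G)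
    (h : (e' : E) = g • (e : E)) :
    (hp.isCoveringMap.monodromy γ e' : E) = g • (hp.isCoveringMap.monodromy γ e : E) := by
  have h1 : e' = hp.toPermFiber x g e := Subtype.ext h
  rw [h1, hp.monodromy_toPermFiber]
  rfl

/-- Monodromy commutes with the action of `G`. Transport of `e` along `δ` ends at some `a • e'`, so
going around `C` and back multiplies `e` by `a * g * a⁻¹`. -/
theorem exists_fundamentalGroupToMulOpposite_eq_conj {x y : X} (e : p ⁻¹' {x}) (δ : Path x y)
    (C : Path y y) (e' : p ⁻¹' {y}) (g : G)
    (hg : (hp.isCoveringMap.monodromy (Path.Homotopic.Quotient.mk C) e' : E) = g • (e' : E)) :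
    ∃ a : G, (hp.fundamentalGroupToMulOpposite e (loopClassAlong δ C)).unop = a * g * a⁻¹ := by
  set cov := hp.isCoveringMap
  have h0 : p (cov.monodromy (Path.Homotopic.Quotient.mk δ) e : E) = p (e' : E) :=
    (cov.monodromy (Path.Homotopic.Quotient.mk δ) e).2.trans e'.2.symm
  obtain ⟨a, ha⟩ := hp.apply_eq_iff_mem_orbit.mp h0
  refine ⟨a, ?_⟩
  have hδ : (cov.monodromy (Path.Homotopic.Quotient.mk δ) e : E) = a • (e' : E) := ha.symm
  have h1 := hp.monodromy_smul (Path.Homotopic.Quotient.mk C) e' _ a hδ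
  rw [hg, smul_smul] at h1
  have h2 : (cov.monodromy (Path.Homotopic.Quotient.mk C)
      (cov.monodromy (Path.Homotopic.Quotient.mk δ) e) : E) =
      (a * g * a⁻¹) • (cov.monodromy (Path.Homotopic.Quotient.mk δ) e : E) := by
    rw [hδ, smul_smul]
    simpa using h1
  have h3 := hp.monodromy_smul (Path.Homotopic.Quotient.mk δ).symm _ _ _ h2
  have h4 : cov.monodromy (Path.Homotopic.Quotient.mk δ).symm
      (cov.monodromy (Path.Homotopic.Quotient.mk δ) e) = e := by
    rw [← cov.monodromy_trans_apply, Path.Homotopic.Quotient.trans_symm, cov.monodromy_refl]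
    rfl
  rw [h4, ← cov.monodromy_trans_apply (Path.Homotopic.Quotient.mk δ),
    ← cov.monodromy_trans_apply] at h3
  rw [← MulOpposite.unop_op (a * g * a⁻¹)]
  congr 1
  rw [hp.fundamentalGroupToMulOpposite_apply_eq_Iff]
  exact h3.symm

end IsQuotientCoveringMap

/-! ### Coordinates on the trinion -/

namespace Trinion

/-- The height of a point of the trinion over the equatorial plane. -/
def height (p : Trinion) : ℝ := p.1 2

/-- The boundary circle on which a point of the trinion lies, if any. -/
noncomputable def rim (p : Trinion) : Option (Fin 3) :=
  if p.1 0 = 4 / 5 then some 0 else if p.1 1 = 4 / 5 then some 1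
  else if p.1 0 = -(4 / 5) then some 2 else none

/-- The sector of the trinion in which a point lies. The intersection of the `a`-th sector with
the equator is the arc from the `a`-th to the `(a+1)`-st boundary circle. -/
noncomputable def sector (p : Trinion) : Fin 3 :=
  if p.1 1 < 0 then 2 else if 0 < p.1 0 then 0 else 1

theorem sq_add_sq_add_sq (p : Trinion) : p.1 0 ^ 2 + p.1 1 ^ 2 + p.1 2 ^ 2 = 1 := by
  have h := p.2.1
  rw [mem_sphere_zero_iff_norm, EuclideanSpace.norm_eq, Real.sqrt_eq_one] at h
  simpa [Fin.sum_univ_three] using h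

theorem coord_le (p : Trinion) : p.1 0 ≤ 4 / 5 ∧ p.1 1 ≤ 4 / 5 ∧ -(4 / 5) ≤ p.1 0 := by
  have h0 := p.2.2 0
  have h1 := p.2.2 1
  have h2 := p.2.2 2
  simp [trinionCenter, PiLp.inner_apply, Fin.sum_univ_three] at h0 h1 h2
  exact ⟨h0, h1, by linarith⟩

theorem continuous_coord (i : Fin 3) : Continuous fun p : Trinion => p.1 i :=
  (EuclideanSpace.proj (𝕜 := ℝ) i).continuous.comp continuous_subtype_val

/-- The three boundary circles are closed and pairwise disjoint, so a point near `p` cannot lie on a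
circle that misses `p`. -/
theorem eventually_rim (p : Trinion) : ∀ᶠ p' in nhds p, rim p' = none ∨ rim p' = rim p := by
  have h := p.sq_add_sq_add_sq
  have ne : ∀ (i : Fin 3) (c : ℝ), p.1 i ≠ c → ∀ᶠ p' in nhds p, p'.1 i ≠ c :=
    fun i c hc => (continuous_coord i).continuousAt.eventually_ne hc
  have key : ∀ p' : Trinion, (p.1 0 ≠ 4 / 5 → p'.1 0 ≠ 4 / 5) → (p.1 1 ≠ 4 / 5 → p'.1 1 ≠ 4 / 5) →
      (p.1 0 ≠ -(4 / 5) → p'.1 0 ≠ -(4 / 5)) → rim p' = none ∨ rim p' = rim p := by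
    intro p' h0 h1 h2
    have e1 : p.1 0 = 4 / 5 → p.1 1 ≠ 4 / 5 := fun e => by nlinarith [sq_nonneg (p.1 2)]
    have e2 : p.1 0 = 4 / 5 → p.1 0 ≠ -(4 / 5) := fun e => by linarith
    have e3 : p.1 1 = 4 / 5 → p.1 0 ≠ -(4 / 5) := fun e => by nlinarith [sq_nonneg (p.1 2)]
    unfold rim
    grind
  have imp : ∀ (i : Fin 3) (c : ℝ), ∀ᶠ p' in nhds p, p.1 i ≠ c → p'.1 i ≠ c := fun i c => by
    by_cases hc : p.1 i = c
    · exact Filter.Eventually.of_forall fun _ h => absurd hc h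
    · filter_upwards [ne i c hc] with p' h' _ using h'
  filter_upwards [imp 0 (4 / 5), imp 1 (4 / 5), imp 0 (-(4 / 5))] with p' using key p'

/-- On the equator the sector could jump only at `(±1, 0)` and `(0, 1)`, which are the centres of
the deleted discs. Jumps away from the equator do occur, but are harmless (see `exists_frame_le`).
-/
theorem eventually_sector (p : Trinion) (hp : p.height = 0) :
    ∀ᶠ p' in nhds p, sector p' = sector p := by
  have h := p.sq_add_sq_add_sq
  obtain ⟨h0, h1, h2⟩ := p.coord_le
  rw [height] at hp
  rw [hp] at h
  have lt : ∀ (i : Fin 3), p.1 i < 0 → ∀ᶠ p' in nhds p, p'.1 i < 0 :=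
    fun i hc => (continuous_coord i).continuousAt.eventually_lt_const hc
  have gt : ∀ (i : Fin 3), 0 < p.1 i → ∀ᶠ p' in nhds p, 0 < p'.1 i :=
    fun i hc => (continuous_coord i).continuousAt.eventually_const_lt hc
  rcases lt_trichotomy (p.1 1) 0 with hy | hy | hy
  · filter_upwards [lt 1 hy] with p' hy'
    simp [sector, hy, hy']
  · exfalso
    nlinarith
  · rcases lt_trichotomy (p.1 0) 0 with hx | hx | hx
    · filter_upwards [gt 1 hy, lt 0 hx] with p' hy' hx'
      simp only [sector, hy.not_gt, hx.not_gt, hy'.not_gt, hx'.not_gt, if_false]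
    · exfalso
      nlinarith
    · filter_upwards [gt 1 hy, gt 0 hx] with p' hy' hx'
      simp only [sector, hy.not_gt, hx, hy'.not_gt, hx', if_false, if_true]

/-- Circle `k` meets only the two sectors adjacent to it; `k + 2` is `k - 1` modulo `3`. -/
theorem sector_of_rim (p : Trinion) (k : Fin 3) (h : rim p = some k) :
    sector p = k ∨ sector p = k + 2 := by
  unfold rim at h
  unfold sector
  split_ifs at h with h0 h1 h2 <;> cases h <;> split_ifs with h3 h4 <;>
    first | decide | (exfalso; linarith)

theorem boundaryPoint_coord (k : Fin 3) (z : Circle) :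
    boundaryPoint k z 0 = ![4 / 5, -(3 / 5 * (z : ℂ).re), -(4 / 5)] k ∧
    boundaryPoint k z 1 = ![3 / 5 * (z : ℂ).re, 4 / 5, -(3 / 5 * (z : ℂ).re)] k ∧
    boundaryPoint k z 2 = 3 / 5 * (z : ℂ).im := by
  fin_cases k <;> simp [boundaryPoint, trinionCenter, trinionTangent, northPole]

theorem height_trinionBoundary (k : Fin 3) (z : Circle) :
    height (trinionBoundary k z) = 3 / 5 * (z : ℂ).im :=
  (boundaryPoint_coord k z).2.2

theorem rim_trinionBoundary (k : Fin 3) (z : Circle) : rim (trinionBoundary k z) = some k := by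
  obtain ⟨h0, h1, -⟩ := boundaryPoint_coord k z
  have hz := circle_re_im z
  have h2 : (z : ℂ).re ≤ 1 := by nlinarith [sq_nonneg (z : ℂ).im]
  have h3 : -1 ≤ (z : ℂ).re := by nlinarith [sq_nonneg (z : ℂ).im]
  simp only [rim, trinionBoundary, h0, h1]
  fin_cases k
  · simp
  · simp
    intro h
    linarith
  · simp
    rw [if_neg (by norm_num), if_neg (by intro h; linarith)]

theorem sector_trinionBoundary_inv (k : Fin 3) (z : Circle) :
    sector (trinionBoundary k z⁻¹) = sector (trinionBoundary k z) := by
  obtain ⟨h0, h1, -⟩ := boundaryPoint_coord k z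
  obtain ⟨h0', h1', -⟩ := boundaryPoint_coord k z⁻¹
  have h : ((z⁻¹ : Circle) : ℂ).re = (z : ℂ).re := by simp
  rw [h] at h0' h1'
  simp only [sector, trinionBoundary, h0, h1, h0', h1']

theorem height_trinionBoundary_inv (k : Fin 3) (z : Circle) :
    height (trinionBoundary k z⁻¹) = -height (trinionBoundary k z) := by
  rw [height_trinionBoundary, height_trinionBoundary, Circle.coe_inv_eq_conj, Complex.conj_im]
  ring

theorem sector_trinionBoundary_one (k : Fin 3) : sector (trinionBoundary k 1) = k := by
  obtain ⟨h0, h1, -⟩ := boundaryPoint_coord k 1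
  simp only [sector, trinionBoundary, h0, h1]
  fin_cases k <;> norm_num
  rfl

theorem sector_trinionBoundary_neg_one (k : Fin 3) :
    sector (trinionBoundary k (-1)) = k + 2 := by
  obtain ⟨h0, h1, -⟩ := boundaryPoint_coord k (-1)
  simp only [sector, trinionBoundary, h0, h1]
  fin_cases k <;> norm_num <;> rfl

theorem circleExp_pi : Circle.exp Real.pi = -1 := by
  ext
  rw [Circle.coe_exp, Complex.exp_pi_mul_I]
  rfl

/-- The upper half of a boundary circle. -/
noncomputable def upperArc (k : Fin 3) : Path (trinionBoundary k 1) (trinionBoundary k (-1)) where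
  toFun t := trinionBoundary k (Circle.exp (Real.pi * (t : ℝ)))
  continuous_toFun := (continuous_trinionBoundary k).comp <| Circle.exp.continuous.comp <|
    continuous_const.mul continuous_subtype_val
  source' := by simp
  target' := by simp [circleExp_pi]

/-- The lower half of a boundary circle. -/
noncomputable def lowerArc (k : Fin 3) : Path (trinionBoundary k (-1)) (trinionBoundary k 1) where
  toFun t := trinionBoundary k (Circle.exp (Real.pi * (1 + (t : ℝ))))
  continuous_toFun := (continuous_trinionBoundary k).comp <| Circle.exp.continuous.comp <|
    continuous_const.mul (continuous_const.add continuous_subtype_val)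
  source' := by simp [circleExp_pi]
  target' := by
    simp only [Set.Icc.coe_one]
    rw [show Real.pi * (1 + 1) = 2 * Real.pi by ring, Circle.exp_two_pi]

theorem height_upperArc (k : Fin 3) (t : unitInterval) : 0 ≤ height (upperArc k t) := by
  refine (height_trinionBoundary _ _).symm ▸ mul_nonneg (by norm_num) ?_
  rw [Circle.coe_exp, Complex.exp_ofReal_mul_I_im]
  exact Real.sin_nonneg_of_nonneg_of_le_pi (mul_nonneg Real.pi_pos.le t.2.1)
    (mul_le_of_le_one_right Real.pi_pos.le t.2.2)

theorem height_lowerArc (k : Fin 3) (t : unitInterval) : height (lowerArc k t) ≤ 0 := by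
  refine (height_trinionBoundary _ _).symm ▸ mul_nonpos_of_nonneg_of_nonpos (by norm_num) ?_
  rw [Circle.coe_exp, Complex.exp_ofReal_mul_I_im, mul_add, mul_one, add_comm, Real.sin_add_pi,
    Left.neg_nonpos_iff]
  exact Real.sin_nonneg_of_nonneg_of_le_pi (mul_nonneg Real.pi_pos.le t.2.1)
    (mul_le_of_le_one_right Real.pi_pos.le t.2.2)

end Trinion

theorem TrivalentGraph.meridian_eq_trans {V : Type} (Γ : TrivalentGraph V) (h : V × Fin 3) :
    Γ.meridian h = ((Trinion.upperArc h.2).map (Γ.continuous_trinion h.1)).trans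
      ((Trinion.lowerArc h.2).map (Γ.continuous_trinion h.1)) := by
  ext t
  rw [Path.trans_apply]
  split_ifs with ht
  · change Γ.trinion _ (trinionBoundary _ (Circle.exp _)) =
      Γ.trinion _ (trinionBoundary _ (Circle.exp _))
    congr 3
    simp only
    ring
  · change Γ.trinion _ (trinionBoundary _ (Circle.exp _)) =
      Γ.trinion _ (trinionBoundary _ (Circle.exp _))
    congr 3
    simp only
    ring

/-! ### Representations from gluing data -/

/-- Data for a `G`-representation of the fundamental group of the surface of a trivalent graph
`Γ`, all of whose edges join half-edges of the same index and vertices of different colours.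
The element `s v a` belongs to the passage between the halves of the trinion `v` through the
`a`-th equatorial arc, and `u h` to the passage through the boundary circle `h`. -/
structure GluingData {V : Type} (Γ : TrivalentGraph V) (G : Type) [Group G] where
  /-- The colour of a vertex. -/
  color : V → Bool
  color_opp : ∀ h, color (Γ.opp h).1 = !color h.1
  opp_snd : ∀ h, (Γ.opp h).2 = h.2
  /-- The passage through an arc. -/
  s : V → Fin 3 → G
  /-- The passage through a boundary circle. -/
  u : V × Fin 3 → G
  u_opp : ∀ h, u (Γ.opp h) = (u h)⁻¹
  compat : ∀ h, (s h.1 h.2)⁻¹ * u h * s (Γ.opp h).1 h.2 =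
    (s h.1 (h.2 + 2))⁻¹ * u h * s (Γ.opp h).1 (h.2 + 2)

/-- The half `ε` of a trinion contains points of signed height `ζ`. -/
def HasHeight (ε : Bool) (ζ : ℝ) : Prop := (ε = true → 0 ≤ ζ) ∧ (ε = false → ζ ≤ 0)

namespace GluingData

variable {V : Type} {Γ : TrivalentGraph V} {G : Type} [Group G] (D : GluingData Γ G)

theorem opp_fst_ne {V : Type} {Γ : TrivalentGraph V} {G : Type} [Group G] (D : GluingData Γ G)
    (h : V × Fin 3) : (Γ.opp h).1 ≠ h.1 := by
  intro e
  have := D.color_opp h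
  rw [e] at this
  cases hc : D.color h.1 <;> simp [hc] at this

/-- The frame of the half `ε` of the trinion `v` relative to its positive half, through the
`a`-th arc. -/
def halfFrame (v : V) (a : Fin 3) (ε : Bool) : G := if ε then 1 else D.s v a

/-- A boundary circle crosses the equator in its two adjacent sectors. The transition between the
same halves of the two trinions must not depend on which crossing is used to compute it; for the
positive halves this is trivial and for the negative ones it is `compat`. -/
theorem compat_halfFrame (h : V × Fin 3) (a a' : Fin 3) (ε : Bool) (ha : a = h.2 ∨ a = h.2 + 2)
    (ha' : a' = h.2 ∨ a' = h.2 + 2) :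
    (D.halfFrame h.1 a ε)⁻¹ * D.u h * D.halfFrame (Γ.opp h).1 a ε =
      (D.halfFrame h.1 a' ε)⁻¹ * D.u h * D.halfFrame (Γ.opp h).1 a' ε := by
  have := D.compat h
  unfold halfFrame
  cases ε
  · rcases ha with rfl | rfl <;> rcases ha' with rfl | rfl <;> simp [this]
  · simp

open Classical in
/-- The frame at a point of the trinion `v` that lies on the boundary circle `b`, at signed height
`ζ`, in the sector `a`. -/
noncomputable def frame (v : V) (b : Option (Fin 3)) (ζ : ℝ) (a : Fin 3) : PartialFrame (V × Bool) G where
  toFun f :=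
    if HasHeight f.2 ζ then
      if f.1 = v then some (D.halfFrame v a f.2)
      else b.elim none fun k =>
        if f.1 = (Γ.opp (v, k)).1 then some (D.u (v, k) * D.halfFrame f.1 a f.2) else none
    else none
  exists_eq_some := by
    rcases le_total 0 ζ with h | h
    · exact ⟨(v, true), D.halfFrame v a true, by simp [HasHeight, h]⟩
    · exact ⟨(v, false), D.halfFrame v a false, by simp [HasHeight, h]⟩

theorem frame_self (v : V) (b : Option (Fin 3)) (ζ : ℝ) (a : Fin 3) (ε : Bool)
    (h : HasHeight ε ζ) :
    (D.frame v b ζ a).toFun (v, ε) = some (D.halfFrame v a ε) := by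
  simp only [frame, if_pos h, if_true]

theorem frame_opp (v : V) (k : Fin 3) (ζ : ℝ) (a : Fin 3) (ε : Bool)
    (h : HasHeight ε ζ) :
    (D.frame v (some k) ζ a).toFun ((Γ.opp (v, k)).1, ε) =
      some (D.u (v, k) * D.halfFrame (Γ.opp (v, k)).1 a ε) := by
  simp only [frame, if_pos h, if_neg (D.opp_fst_ne (v, k)), Option.elim_some, if_true]

theorem frame_eq_some (v : V) (b : Option (Fin 3)) (ζ : ℝ) (a : Fin 3) (w : V) (ε : Bool) (g : G)
    (h : (D.frame v b ζ a).toFun (w, ε) = some g) :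
    HasHeight ε ζ ∧ ((w = v ∧ g = D.halfFrame v a ε) ∨
      ∃ k, b = some k ∧ w = (Γ.opp (v, k)).1 ∧ g = D.u (v, k) * D.halfFrame w a ε) := by
  simp only [frame] at h
  split_ifs at h with h1 h2
  · exact ⟨h1, Or.inl ⟨h2, (Option.some_inj.mp h).symm⟩⟩
  · cases b with
    | none => simp at h
    | some k =>
      simp only [Option.elim_some] at h
      split_ifs at h with h3
      exact ⟨h1, Or.inr ⟨k, rfl, h3, (Option.some_inj.mp h).symm⟩⟩

/-- On the equator the sectors agree and `g = 1` works. Away from it only one half is present, so a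
change of sector amounts to a single left translation; on the entries of the neighbouring trinion
`compat_halfFrame` shows that the same translation works. -/
theorem exists_frame_le (v : V) (b b' : Option (Fin 3)) (ζ ζ' : ℝ) (a a' : Fin 3)
    (hb : b' = none ∨ b' = b) (h0 : ζ = 0 → a' = a) (hpos : 0 < ζ → 0 < ζ') (hneg : ζ < 0 → ζ' < 0)
    (ha : ∀ k, b = some k → a = k ∨ a = k + 2) (ha' : ∀ k, b' = some k → a' = k ∨ a' = k + 2) :
    ∃ g : G, D.frame v b ζ a ≤ g • D.frame v b' ζ' a' := by
  have key : ∃ g : G, ∀ ε : Bool, HasHeight ε ζ' →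
      HasHeight ε ζ ∧
        g = D.halfFrame v a ε * (D.halfFrame v a' ε)⁻¹ := by
    rcases lt_trichotomy ζ 0 with h | h | h
    · refine ⟨D.halfFrame v a false * (D.halfFrame v a' false)⁻¹, fun ε hε => ?_⟩
      have := hneg h
      cases ε
      · exact ⟨⟨by simp, fun _ => h.le⟩, rfl⟩
      · linarith [hε.1 rfl]
    · refine ⟨1, fun ε _ => ⟨⟨fun _ => h.ge, fun _ => h.le⟩, ?_⟩⟩
      rw [h0 h]
      simp
    · refine ⟨D.halfFrame v a true * (D.halfFrame v a' true)⁻¹, fun ε hε => ?_⟩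
      have := hpos h
      cases ε
      · linarith [hε.2 rfl]
      · exact ⟨⟨fun _ => h.le, by simp⟩, rfl⟩
  obtain ⟨g, hg⟩ := key
  refine ⟨g, ?_⟩
  rintro ⟨w, ε⟩ x hx
  rw [PartialFrame.smul_toFun, Option.map_eq_some_iff] at hx
  obtain ⟨y, hy, rfl⟩ := hx
  obtain ⟨hε, h | ⟨k, hk, hw, rfl⟩⟩ := D.frame_eq_some _ _ _ _ _ _ _ hy
  · obtain ⟨rfl, rfl⟩ := h
    obtain ⟨h1, rfl⟩ := hg ε hε
    rw [D.frame_self _ _ _ _ _ h1]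
    simp
  · obtain ⟨h1, rfl⟩ := hg ε hε
    have hbk : b = some k := by
      rcases hb with hb | hb
      · rw [hb] at hk
        cases hk
      · rw [← hb, hk]
    subst hbk
    subst hw
    have h2 := D.compat_halfFrame (v, k) a a' ε (ha k rfl) (ha' k hk)
    rw [D.frame_opp _ _ _ _ _ h1, Option.some_inj, mul_assoc, ← mul_assoc _⁻¹, ← h2]
    group

theorem frame_opp_eq (v : V) (k : Fin 3) (ζ : ℝ) (a : Fin 3) :
    D.frame v (some k) ζ a = D.u (v, k) • D.frame (Γ.opp (v, k)).1 (some k) ζ a := by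
  have ho : Γ.opp ((Γ.opp (v, k)).1, k) = (v, k) := by
    have h1 : Γ.opp (v, k) = ((Γ.opp (v, k)).1, k) := Prod.ext rfl (D.opp_snd (v, k))
    rw [← h1, Γ.opp_opp]
  have hu : D.u ((Γ.opp (v, k)).1, k) = (D.u (v, k))⁻¹ := by
    rw [← D.u_opp]
    exact congrArg D.u (Prod.ext rfl (D.opp_snd (v, k)).symm)
  apply PartialFrame.ext
  funext ⟨w, ε⟩
  rw [PartialFrame.smul_toFun]
  have hne := D.opp_fst_ne (v, k)
  by_cases hε : HasHeight ε ζ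
  · by_cases h1 : w = v
    · subst h1
      simp only [frame, if_pos hε, Option.elim_some]
      simp [hne.symm, ho, hu]
    · by_cases h2 : w = (Γ.opp (v, k)).1
      · subst h2
        simp only [frame, if_pos hε, Option.elim_some]
        simp [hne]
      · simp only [frame, if_pos hε, Option.elim_some]
        simp [h1, h2, ho]
  · simp only [frame, if_neg hε]
    rfl

/-- The signed height of a point of the trinion `v`. -/
noncomputable def signedHeight (v : V) (p : Trinion) : ℝ := if D.color v then -p.height else p.height

/-- The frame at a point of the trinion `v`. -/
noncomputable def frameAt (v : V) (p : Trinion) : PartialFrame (V × Bool) G :=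
  D.frame v p.rim (D.signedHeight v p) p.sector

theorem eventually_frameAt (v : V) (p : Trinion) :
    ∀ᶠ p' in nhds p, ∃ g : G, D.frameAt v p ≤ g • D.frameAt v p' := by
  have hs : Continuous (D.signedHeight v) := by
    unfold signedHeight
    split_ifs
    · exact (Trinion.continuous_coord 2).neg
    · exact Trinion.continuous_coord 2
  have h0 : ∀ᶠ p' in nhds p, D.signedHeight v p = 0 → p'.sector = p.sector := by
    by_cases h : p.height = 0
    · filter_upwards [p.eventually_sector h] with p' h' _ using h'
    · refine Filter.Eventually.of_forall fun p' h' => absurd ?_ h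
      unfold signedHeight at h'
      split_ifs at h' <;> simpa using h'
  have hpos : ∀ᶠ p' in nhds p, 0 < D.signedHeight v p → 0 < D.signedHeight v p' := by
    by_cases h : 0 < D.signedHeight v p
    · filter_upwards [hs.continuousAt.eventually_const_lt h] with p' h' _ using h'
    · exact Filter.Eventually.of_forall fun p' h' => absurd h' h
  have hneg : ∀ᶠ p' in nhds p, D.signedHeight v p < 0 → D.signedHeight v p' < 0 := by
    by_cases h : D.signedHeight v p < 0
    · filter_upwards [hs.continuousAt.eventually_lt_const h] with p' h' _ using h'
    · exact Filter.Eventually.of_forall fun p' h' => absurd h' h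
  filter_upwards [h0, hpos, hneg, p.eventually_rim] with p' h0' hpos' hneg' hb
  exact D.exists_frame_le v _ _ _ _ _ _ hb h0' hpos' hneg' p.sector_of_rim p'.sector_of_rim

theorem toClass_frameAt_glue (h : V × Fin 3) (z : Circle) :
    (D.frameAt h.1 (trinionBoundary h.2 z)).toClass =
      (D.frameAt (Γ.opp h).1 (trinionBoundary (Γ.opp h).2 z⁻¹)).toClass := by
  obtain ⟨v, k⟩ := h
  -- The gluing `z ↦ z⁻¹` reverses heights, and the opposite colours of the two vertices compensate
  -- for this. So upper halves are glued to lower ones, but positive halves to positive ones.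
  have hs : D.signedHeight (Γ.opp (v, k)).1 (trinionBoundary k z⁻¹) =
      D.signedHeight v (trinionBoundary k z) := by
    have hc := D.color_opp (v, k)
    unfold signedHeight
    rw [hc, Trinion.height_trinionBoundary_inv]
    cases D.color v <;> simp
  rw [PartialFrame.toClass_eq_iff]
  refine ⟨D.u (v, k), ?_⟩
  rw [D.opp_snd]
  unfold frameAt
  rw [hs, Trinion.rim_trinionBoundary, Trinion.rim_trinionBoundary,
    Trinion.sector_trinionBoundary_inv, ← D.frame_opp_eq]

/-- The map from the surface to the space of classes of frames. -/
noncomputable def classMap : C(Γ.Surface, PartialFrame.Class (V × Bool) G) where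
  toFun := Quot.lift (fun y => (D.frameAt y.1 y.2).toClass) (by
    rintro _ _ ⟨h, z⟩
    exact D.toClass_frameAt_glue h z)
  continuous_toFun := by
    refine continuous_quot_lift _ (continuous_sigma fun v => ?_)
    exact PartialFrame.continuous_toClass_comp _ (D.eventually_frameAt v)

theorem continuous_smul_frameAt {p q : Trinion} (v : V) (γ : Path p q) (ε : Bool)
    (hε : ∀ t, HasHeight ε (D.signedHeight v (γ t))) :
    Continuous fun t => (D.halfFrame v (γ t).sector ε)⁻¹ • D.frameAt v (γ t) :=
  PartialFrame.continuous_normalize (fun t => D.frameAt v (γ t))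
    (fun t => γ.continuous.continuousAt.eventually (D.eventually_frameAt v (γ t)))
    (v, ε) _ fun t => D.frame_self _ _ _ _ _ (hε t)

/-- While `γ` stays in the half `ε`, the frames normalised at `(v, ε)` vary continuously and hence
form a lift; lifts are unique. -/
theorem monodromy_path {p q : Trinion} (v : V) (γ : Path p q) (ε : Bool)
    (hε : ∀ t, HasHeight ε (D.signedHeight v (γ t)))
    (e : PartialFrame.toClass ⁻¹' {D.classMap (Γ.trinion v p)}) (g : G)
    (he : (e : PartialFrame (V × Bool) G) = g • D.frameAt v p) :
    ((PartialFrame.isQuotientCoveringMap_toClass (F := V × Bool) (G := G)).isCoveringMap.monodromy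
      (Path.Homotopic.Quotient.mk
        ((γ.map (Γ.continuous_trinion v)).map D.classMap.continuous)) e :
        PartialFrame (V × Bool) G) =
      (g * D.halfFrame v p.sector ε * (D.halfFrame v q.sector ε)⁻¹) • D.frameAt v q := by
  set hp := PartialFrame.isQuotientCoveringMap_toClass (F := V × Bool) (G := G)
  have h1 := IsCoveringMap.monodromy_mk_eq hp.isCoveringMap
    ((γ.map (Γ.continuous_trinion v)).map D.classMap.continuous)
    (fun t => (g * D.halfFrame v p.sector ε) •
      ((D.halfFrame v (γ t).sector ε)⁻¹ • D.frameAt v (γ t)))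
    ((hp.continuous_const_smul _).comp (D.continuous_smul_frameAt v γ ε hε))
    (fun t => by rw [hp.map_smul, hp.map_smul]; rfl) e
    (by simp [he, smul_smul])
  rw [h1]
  simp [smul_smul]

/-- The upper semicircle leads from sector `k` to sector `k + 2` in one half, the lower one leads
back in the other. Only the negative half contributes, and the colour decides which semicircle that
is; hence the two alternatives. -/
theorem monodromy_meridian (h : V × Fin 3)
    (e : PartialFrame.toClass ⁻¹' {D.classMap (Γ.trinion h.1 (trinionBoundary h.2 1))})
    (he : (e : PartialFrame (V × Bool) G) = D.frameAt h.1 (trinionBoundary h.2 1)) :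
    ∃ g : G, (g = D.s h.1 (h.2 + 2) * (D.s h.1 h.2)⁻¹ ∨
        g = D.s h.1 h.2 * (D.s h.1 (h.2 + 2))⁻¹) ∧
      ((PartialFrame.isQuotientCoveringMap_toClass (F := V × Bool)
        (G := G)).isCoveringMap.monodromy
        (Path.Homotopic.Quotient.mk ((Γ.meridian h).map D.classMap.continuous)) e :
        PartialFrame (V × Bool) G) = g • (e : PartialFrame (V × Bool) G) := by
  set cov := (PartialFrame.isQuotientCoveringMap_toClass (F := V × Bool) (G := G)).isCoveringMap
  obtain ⟨v, k⟩ := h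
  have hup : ∀ t, HasHeight (!D.color v) (D.signedHeight v (Trinion.upperArc k t)) := by
    intro t
    have := Trinion.height_upperArc k t
    unfold signedHeight HasHeight
    cases D.color v <;> simpa
  have hlow : ∀ t, HasHeight (D.color v) (D.signedHeight v (Trinion.lowerArc k t)) := by
    intro t
    have := Trinion.height_lowerArc k t
    unfold signedHeight HasHeight
    cases D.color v <;> simpa
  have h1 := D.monodromy_path v (Trinion.upperArc k) _ hup e 1 (by rw [one_smul, he])
  have h2 := D.monodromy_path v (Trinion.lowerArc k) _ hlow _ _ h1
  have h3 : cov.monodromy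
      (Path.Homotopic.Quotient.mk ((Γ.meridian (v, k)).map D.classMap.continuous)) e =
      cov.monodromy (Path.Homotopic.Quotient.mk (((Trinion.lowerArc k).map
        (Γ.continuous_trinion v)).map D.classMap.continuous))
      (cov.monodromy (Path.Homotopic.Quotient.mk (((Trinion.upperArc k).map
        (Γ.continuous_trinion v)).map D.classMap.continuous)) e) := by
    rw [Γ.meridian_eq_trans, Path.map_trans, Path.Homotopic.Quotient.mk_trans,
      cov.monodromy_trans_apply]
  refine ⟨_, ?_, (congrArg Subtype.val h3).trans (h2.trans (by rw [he]))⟩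
  rw [Trinion.sector_trinionBoundary_one, Trinion.sector_trinionBoundary_neg_one]
  unfold halfFrame
  cases D.color v <;> simp

/-- The representation given by gluing data. -/
theorem exists_representation (x : Γ.Surface) :
    ∃ ρ : FundamentalGroup Γ.Surface x →* G, ∀ (h : V × Fin 3)
      (δ : Path x (Γ.trinion h.1 (trinionBoundary h.2 1))), ∃ a g : G,
        (g = D.s h.1 (h.2 + 2) * (D.s h.1 h.2)⁻¹ ∨ g = D.s h.1 h.2 * (D.s h.1 (h.2 + 2))⁻¹) ∧
        ρ (loopClassAlong δ (Γ.meridian h)) = a * g⁻¹ * a⁻¹ := by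
  set hp := PartialFrame.isQuotientCoveringMap_toClass (F := V × Bool) (G := G)
  obtain ⟨e, he⟩ := hp.surjective (D.classMap x)
  let σ := hp.fundamentalGroupToMulOpposite (⟨e, he⟩ : PartialFrame.toClass ⁻¹' {D.classMap x})
  -- Monodromy takes values in the opposite group. Inversion makes it a homomorphism to `G`, which
  -- is why `g⁻¹` appears.
  refine ⟨((MulEquiv.inv' G).symm.toMonoidHom.comp σ).comp (FundamentalGroup.map D.classMap x),
    fun h δ => ?_⟩
  obtain ⟨g, hg, hm⟩ := D.monodromy_meridian h ⟨D.frameAt h.1 (trinionBoundary h.2 1), rfl⟩ rfl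
  obtain ⟨a, ha⟩ := hp.exists_fundamentalGroupToMulOpposite_eq_conj ⟨e, he⟩
    (δ.map D.classMap.continuous) ((Γ.meridian h).map D.classMap.continuous) _ g hm
  refine ⟨a, g, hg, ?_⟩
  have h1 : FundamentalGroup.map D.classMap x (loopClassAlong δ (Γ.meridian h)) =
      loopClassAlong (δ.map D.classMap.continuous)
        ((Γ.meridian h).map D.classMap.continuous) := by
    unfold loopClassAlong
    rw [← Path.map_trans, Path.map_symm, ← Path.map_trans]
    rfl
  rw [MonoidHom.comp_apply, h1, MonoidHom.comp_apply]
  change (MulOpposite.unop (σ _))⁻¹ = _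
  rw [ha]
  group

end GluingData

/-! ### The two halves of the trinion -/

namespace Trinion

theorem mem_trinionShadow (p : Trinion) : (p.1 0, p.1 1) ∈ trinionShadow := by
  have h1 := p.sq_add_sq_add_sq
  obtain ⟨h2, h3, h4⟩ := p.coord_le
  exact ⟨by nlinarith [sq_nonneg (p.1 2)], h2, h3, by simp only; linarith⟩

/-- The vertical projection of the trinion to its shadow. -/
def shadow (p : Trinion) : trinionShadow := ⟨(p.1 0, p.1 1), p.mem_trinionShadow⟩

theorem continuous_shadow : Continuous shadow :=
  ((continuous_coord 0).prodMk (continuous_coord 1)).subtype_mk _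

/-- The section of the vertical projection with values in the half `ε` of the trinion. -/
noncomputable def ofShadow (ε : ℝ) (hε : ε ^ 2 = 1) (y : trinionShadow) : Trinion :=
  ⟨trinionLift ε y, trinionLift_mem ε hε y y.2⟩

theorem continuous_ofShadow (ε : ℝ) (hε : ε ^ 2 = 1) : Continuous (ofShadow ε hε) := by
  refine Continuous.subtype_mk ?_ _
  unfold trinionLift
  fun_prop

theorem ofShadow_shadow (ε : ℝ) (hε : ε ^ 2 = 1) (p : Trinion) (hp : 0 ≤ ε * height p) :
    ofShadow ε hε (shadow p) = p := by
  have h1 : 1 - p.1 0 ^ 2 - p.1 1 ^ 2 = (ε * height p) ^ 2 := by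
    rw [mul_pow, hε, height]
    linarith [p.sq_add_sq_add_sq]
  apply Subtype.ext
  ext i
  fin_cases i
  · simp [ofShadow, shadow, trinionLift]
  · simp [ofShadow, shadow, trinionLift]
  · simp only [ofShadow, shadow, trinionLift, h1, Real.sqrt_sq hp]
    rw [← mul_assoc, ← sq, hε, one_mul]
    rfl

theorem height_ofShadow (ε : ℝ) (hε : ε ^ 2 = 1) (y : trinionShadow) :
    0 ≤ ε * height (ofShadow ε hε y) := by
  simp only [height, ofShadow, trinionLift]
  change 0 ≤ ε * (ε * √_)
  rw [← mul_assoc, ← sq, hε, one_mul]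
  exact Real.sqrt_nonneg _

instance : ContractibleSpace trinionShadow :=
  convex_trinionShadow.contractibleSpace ⟨(0, 0), by norm_num [trinionShadow]⟩

/-- Paths in one half are recovered from their projections to the convex shadow, where any two paths
with the same ends are homotopic. -/
theorem homotopic_of_height {p q : Trinion} (ε : ℝ) (hε : ε ^ 2 = 1) (γ γ' : Path p q)
    (h : ∀ t, 0 ≤ ε * height (γ t)) (h' : ∀ t, 0 ≤ ε * height (γ' t)) :
    Path.Homotopic γ γ' := by
  have hc := continuous_ofShadow ε hε
  have key : ((γ.map continuous_shadow).map hc).Homotopic ((γ'.map continuous_shadow).map hc) :=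
    (SimplyConnectedSpace.paths_homotopic (γ.map continuous_shadow)
      (γ'.map continuous_shadow)).map ⟨_, hc⟩
  have hp := ofShadow_shadow ε hε p (by simpa using h 0)
  have hq := ofShadow_shadow ε hε q (by simpa using h 1)
  have e : ((γ.map continuous_shadow).map hc).cast hp.symm hq.symm = γ := by
    ext1
    funext t
    exact ofShadow_shadow ε hε _ (h t)
  have e' : ((γ'.map continuous_shadow).map hc).cast hp.symm hq.symm = γ' := by
    ext1
    funext t
    exact ofShadow_shadow ε hε _ (h' t)
  rw [← e, ← e']
  obtain ⟨K⟩ := key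
  exact ⟨K.cast rfl rfl⟩

theorem exists_path_half (ε : ℝ) (hε : ε ^ 2 = 1) (p q : Trinion) (hp : 0 ≤ ε * height p)
    (hq : 0 ≤ ε * height q) : ∃ γ : Path p q, ∀ t, 0 ≤ ε * height (γ t) :=
  ⟨((PathConnectedSpace.somePath (shadow p) (shadow q)).map (continuous_ofShadow ε hε)).cast
    (ofShadow_shadow ε hε p hp).symm (ofShadow_shadow ε hε q hq).symm,
    fun _ => height_ofShadow ε hε _⟩

/-- The path is parametrised by the first coordinate; `σ` selects the front or the back semicircle
of the equator, and `h` keeps the path out of the deleted discs. -/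
theorem exists_path_equator (p q : Trinion) (a b σ : ℝ) (hp : p.1 = !₂[a, σ * √(1 - a ^ 2), 0])
    (hq : q.1 = !₂[b, σ * √(1 - b ^ 2), 0]) (hσ : σ ^ 2 = 1)
    (h : ∀ x ∈ Set.uIcc a b, -(4 / 5) ≤ x ∧ x ≤ 4 / 5 ∧ σ * √(1 - x ^ 2) ≤ 4 / 5) :
    ∃ γ : Path p q, ∀ t, height (γ t) = 0 := by
  have hm : ∀ t : unitInterval, AffineMap.lineMap a b (t : ℝ) ∈ Set.uIcc a b := fun t => by
    rw [← segment_eq_uIcc, segment_eq_image_lineMap]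
    exact ⟨t, t.2, rfl⟩
  let c : ℝ → EuclideanSpace ℝ (Fin 3) := fun x => !₂[x, σ * √(1 - x ^ 2), 0]
  have hc : ∀ x ∈ Set.uIcc a b, c x ∈ Metric.sphere (0 : EuclideanSpace ℝ (Fin 3)) 1 ∧
      ∀ k, inner ℝ (trinionCenter k) (c x) ≤ 4 / 5 := by
    intro x hx
    obtain ⟨h1, h2, h3⟩ := h x hx
    have hs := Real.sq_sqrt (show 0 ≤ 1 - x ^ 2 by nlinarith)
    constructor
    · rw [mem_sphere_zero_iff_norm, EuclideanSpace.norm_eq, Real.sqrt_eq_one]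
      simp [c, Fin.sum_univ_three, mul_pow, hσ, hs]
    · intro k
      fin_cases k <;> simp [c, trinionCenter, PiLp.inner_apply, Fin.sum_univ_three] <;> linarith
  have hcont : Continuous c := by fun_prop
  refine ⟨⟨⟨fun t => ⟨c (AffineMap.lineMap a b (t : ℝ)), hc _ (hm t)⟩, ?_⟩, ?_, ?_⟩, ?_⟩
  · refine Continuous.subtype_mk (hcont.comp ?_) _
    exact AffineMap.lineMap_continuous.comp continuous_subtype_val
  · apply Subtype.ext
    simp [hp, c]
  · apply Subtype.ext
    simp [hq, c]
  · intro t
    rfl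

theorem exists_path_arc (k : Fin 3) :
    ∃ γ : Path (trinionBoundary (k + 2) 1) (trinionBoundary k (-1)), ∀ t, height (γ t) = 0 := by
  have hc : ∀ k z, (trinionBoundary k z).1 =
      !₂[![4 / 5, -(3 / 5 * (z : ℂ).re), -(4 / 5)] k,
        ![3 / 5 * (z : ℂ).re, 4 / 5, -(3 / 5 * (z : ℂ).re)] k, 3 / 5 * (z : ℂ).im] := by
    intro k z
    obtain ⟨h0, h1, h2⟩ := boundaryPoint_coord k z
    ext i
    fin_cases i
    · exact h0
    · exact h1
    · exact h2
  have s1 : √(1 - (4 / 5 : ℝ) ^ 2) = 3 / 5 := by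
    rw [show (1 - (4 / 5 : ℝ) ^ 2) = (3 / 5) ^ 2 by norm_num, Real.sqrt_sq (by norm_num)]
  have s2 : √(1 - (3 / 5 : ℝ) ^ 2) = 4 / 5 := by
    rw [show (1 - (3 / 5 : ℝ) ^ 2) = (4 / 5) ^ 2 by norm_num, Real.sqrt_sq (by norm_num)]
  fin_cases k
  · refine exists_path_equator _ _ (-(4 / 5)) (4 / 5) (-1) ?_ ?_ (by norm_num) ?_
    · rw [hc, neg_sq, s1]
      simp
    · rw [hc, s1]
      simp
    · intro x hx
      rw [Set.uIcc_of_le (by norm_num)] at hx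
      exact ⟨hx.1, hx.2, by linarith [Real.sqrt_nonneg (1 - x ^ 2)]⟩
  · refine exists_path_equator _ _ (4 / 5) (3 / 5) 1 ?_ ?_ (by norm_num) ?_
    · rw [hc, s1]
      simp
    · rw [hc, s2]
      simp
    · intro x hx
      rw [Set.uIcc_of_ge (by norm_num)] at hx
      refine ⟨by linarith [hx.1], hx.2, ?_⟩
      rw [one_mul, ← s2]
      exact Real.sqrt_le_sqrt (by nlinarith [hx.1])
  · refine exists_path_equator _ _ (-(3 / 5)) (-(4 / 5)) 1 ?_ ?_ (by norm_num) ?_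
    · rw [hc, neg_sq, s2]
      simp
    · rw [hc, neg_sq, s1]
      simp
    · intro x hx
      rw [Set.uIcc_of_ge (by norm_num)] at hx
      refine ⟨hx.1, by linarith [hx.2], ?_⟩
      rw [one_mul, ← s2]
      exact Real.sqrt_le_sqrt (by nlinarith [hx.2])

end Trinion

/-! ### Holonomy along paths -/

/-- The holonomy of a representation along a path. -/
noncomputable def holonomy {X G : Type} [TopologicalSpace X] [PathConnectedSpace X] [Group G]
    {x : X} (ρ : FundamentalGroup X x →* G) {p q : X} (γ : Path p q) : G :=
  (ρ (FundamentalGroup.fromPath (Path.Homotopic.Quotient.mk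
    (((PathConnectedSpace.somePath x p).trans γ).trans
      (PathConnectedSpace.somePath x q).symm))))⁻¹

section Holonomy

variable {X G : Type} [TopologicalSpace X] [PathConnectedSpace X] [Group G] {x : X}
  (ρ : FundamentalGroup X x →* G)

theorem holonomy_loop {p : X} (C : Path p p) : holonomy ρ C = (ρ (loopClass x C))⁻¹ := rfl

theorem holonomy_eq_of_homotopic {p q : X} {γ γ' : Path p q} (h : γ.Homotopic γ') :
    holonomy ρ γ = holonomy ρ γ' := by
  have e : Path.Homotopic.Quotient.mk γ = Path.Homotopic.Quotient.mk γ' :=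
    Path.Homotopic.Quotient.eq.mpr h
  unfold holonomy
  simp only [Path.Homotopic.Quotient.mk_trans, e]

-- Multiplication in the fundamental group is opposite to concatenation of loops. The inverse in
-- `holonomy` makes it multiplicative in the order of concatenation.
open CategoryTheory in
theorem holonomy_trans {p q r : X} (γ : Path p q) (γ' : Path q r) :
    holonomy ρ (γ.trans γ') = holonomy ρ γ * holonomy ρ γ' := by
  unfold holonomy
  rw [← mul_inv_rev, ← map_mul]
  congr 2
  let a : FundamentalGroupoid.mk x ⟶ FundamentalGroupoid.mk p :=
    Path.Homotopic.Quotient.mk (PathConnectedSpace.somePath x p)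
  let b : FundamentalGroupoid.mk x ⟶ FundamentalGroupoid.mk q :=
    Path.Homotopic.Quotient.mk (PathConnectedSpace.somePath x q)
  let c : FundamentalGroupoid.mk x ⟶ FundamentalGroupoid.mk r :=
    Path.Homotopic.Quotient.mk (PathConnectedSpace.somePath x r)
  let l : FundamentalGroupoid.mk p ⟶ FundamentalGroupoid.mk q := Path.Homotopic.Quotient.mk γ
  let l' : FundamentalGroupoid.mk q ⟶ FundamentalGroupoid.mk r := Path.Homotopic.Quotient.mk γ'
  change (a ≫ (l ≫ l')) ≫ Groupoid.inv c =
    ((a ≫ l) ≫ Groupoid.inv b) ≫ ((b ≫ l') ≫ Groupoid.inv c)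
  simp [Groupoid.inv_eq_inv]

end Holonomy

namespace TrivalentGraph

variable {V : Type} (Γ : TrivalentGraph V) [PathConnectedSpace Γ.Surface]

/-- The holonomies around the three boundary circles of a trinion are, up to conjugation,
quotients of the members of a cyclic triple. -/
theorem exists_holonomy_meridian {G : Type} [Group G] {x : Γ.Surface}
    (ρ : FundamentalGroup Γ.Surface x →* G) (v : V) :
    ∃ d : Fin 3 → G, ∀ k, ∃ g : G,
      holonomy ρ (Γ.meridian (v, k)) = g * (d (k + 2) * (d k)⁻¹) * g⁻¹ := by
  let o : Trinion := trinionBoundary 0 1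
  have h1 : ∀ k, (trinionBoundary k 1).height = 0 := fun k => by
    rw [Trinion.height_trinionBoundary]
    simp
  -- On one half the holonomy is path independent, so it is given by a potential `H`: the holonomy
  -- from the base point `o`, which lies on the equator and so in both halves.
  have main : ∀ ε : ℝ, ε ^ 2 = 1 → ∃ H : Trinion → G, ∀ (p q : Trinion) (γ : Path p q),
      (∀ t, 0 ≤ ε * (γ t).height) →
        holonomy ρ (γ.map (Γ.continuous_trinion v)) = (H p)⁻¹ * H q := by
    intro ε hε
    have ex : ∀ p : Trinion, ∃ g : G, 0 ≤ ε * p.height → ∃ δ : Path o p,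
        (∀ t, 0 ≤ ε * (δ t).height) ∧ holonomy ρ (δ.map (Γ.continuous_trinion v)) = g := by
      intro p
      by_cases hp : 0 ≤ ε * p.height
      · obtain ⟨δ, hδ⟩ := Trinion.exists_path_half ε hε o p (by rw [h1, mul_zero]) hp
        exact ⟨_, fun _ => ⟨δ, hδ, rfl⟩⟩
      · exact ⟨1, fun h => absurd h hp⟩
    choose H hH using ex
    refine ⟨H, fun p q γ hγ => ?_⟩
    obtain ⟨δ, hδ, hp⟩ := hH p (by simpa using hγ 0)
    obtain ⟨δ', hδ', hq⟩ := hH q (by simpa using hγ 1)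
    have hom : (δ.trans γ).Homotopic δ' := by
      refine Trinion.homotopic_of_height ε hε _ _ (fun t => ?_) hδ'
      rw [Path.trans_apply]
      split_ifs
      · exact hδ _
      · exact hγ _
    rw [← hp, ← hq, ← holonomy_eq_of_homotopic ρ (hom.map ⟨_, Γ.continuous_trinion v⟩)]
    rw [eq_inv_mul_iff_mul_eq, ← holonomy_trans, ← Path.map_trans]
  obtain ⟨U, hU⟩ := main 1 (by norm_num)
  obtain ⟨L, hL⟩ := main (-1) (by norm_num)
  -- Along an equatorial arc both potentials compute the same holonomy, so `U * L⁻¹` takes the same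
  -- value at both ends.
  have hd : ∀ k, U (trinionBoundary (k + 2) 1) * (L (trinionBoundary (k + 2) 1))⁻¹ =
      U (trinionBoundary k (-1)) * (L (trinionBoundary k (-1)))⁻¹ := by
    intro k
    obtain ⟨γ, hγ⟩ := Trinion.exists_path_arc k
    have e := (hU _ _ γ fun t => by rw [hγ, mul_zero]).symm.trans
      (hL _ _ γ fun t => by rw [hγ, mul_zero])
    rw [inv_mul_eq_iff_eq_mul] at e
    rw [e]
    group
  refine ⟨fun k => U (trinionBoundary k 1) * (L (trinionBoundary k 1))⁻¹, fun k =>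
    ⟨(U (trinionBoundary k 1))⁻¹, ?_⟩⟩
  beta_reduce
  rw [hd, Γ.meridian_eq_trans, holonomy_trans,
    hU _ _ (Trinion.upperArc k) fun t => by simpa using Trinion.height_upperArc k t,
    hL _ _ (Trinion.lowerArc k) fun t => by simpa using Trinion.height_lowerArc k t]
  group

end TrivalentGraph

/-! ### The group `SU(2)` -/

open ComplexConjugate

/-- The complex matrix of the quaternion `a + b j`. -/
def quaternionMatrix (a b : ℂ) : Matrix (Fin 2) (Fin 2) ℂ := !![a, b; -conj b, conj a]

theorem quaternionMatrix_mul (a b c d : ℂ) :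
    quaternionMatrix a b * quaternionMatrix c d =
      quaternionMatrix (a * c - b * conj d) (a * d + b * conj c) := by
  unfold quaternionMatrix
  ext i j
  fin_cases i <;> fin_cases j <;> simp [Matrix.mul_apply, Fin.sum_univ_two] <;> ring

theorem star_quaternionMatrix (a b : ℂ) :
    star (quaternionMatrix a b) = quaternionMatrix (conj a) (-b) := by
  unfold quaternionMatrix
  ext i j
  fin_cases i <;> fin_cases j <;> simp [Matrix.star_apply]

theorem quaternionMatrix_one_zero : quaternionMatrix 1 0 = 1 := by
  unfold quaternionMatrix
  ext i j
  fin_cases i <;> fin_cases j <;> simp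

theorem quaternionMatrix_mem (a b : ℂ) (h : a * conj a + b * conj b = 1) :
    quaternionMatrix a b ∈ Matrix.specialUnitaryGroup (Fin 2) ℂ := by
  rw [Matrix.mem_specialUnitaryGroup_iff, Matrix.mem_unitaryGroup_iff, star_quaternionMatrix,
    quaternionMatrix_mul]
  constructor
  · rw [← quaternionMatrix_one_zero]
    congr 1
    · simpa using h
    · rw [Complex.conj_conj]
      ring
  · rw [quaternionMatrix, Matrix.det_fin_two_of, ← h]
    ring

namespace SU2

/-- The element of `SU(2)` with first row `(a, b)`. -/
def mk (a b : ℂ) (h : a * conj a + b * conj b = 1) : SU2 :=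
  ⟨quaternionMatrix a b, quaternionMatrix_mem a b h⟩

theorem exists_eq_mk (A : SU2) : ∃ a b h, A = mk a b h := by
  obtain ⟨M, hM⟩ := A
  have hd := (Matrix.mem_specialUnitaryGroup_iff.mp hM).2
  have hu := Matrix.mem_unitaryGroup_iff'.mp (Matrix.mem_specialUnitaryGroup_iff.mp hM).1
  have hs : star M = M.adjugate := by
    have h1 : M * M.adjugate = 1 := by rw [Matrix.mul_adjugate, hd, one_smul]
    calc star M = star M * (M * M.adjugate) := by rw [h1, mul_one]
      _ = M.adjugate := by rw [← mul_assoc, hu, one_mul]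
  rw [Matrix.adjugate_fin_two] at hs
  have h00 : conj (M 0 0) = M 1 1 := by simpa using congrFun (congrFun hs 0) 0
  have h10 : conj (M 0 1) = -M 1 0 := by simpa using congrFun (congrFun hs 1) 0
  have hM2 : M = quaternionMatrix (M 0 0) (M 0 1) := by
    rw [quaternionMatrix, h00, h10, neg_neg]
    exact Matrix.eta_fin_two M
  refine ⟨M 0 0, M 0 1, ?_, Subtype.ext hM2⟩
  rw [h00, h10, ← hd, Matrix.det_fin_two]
  ring

theorem su2Angle_inv (A : SU2) : su2Angle A⁻¹ = su2Angle A := by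
  obtain ⟨a, b, h, rfl⟩ := exists_eq_mk A
  have h1 : ((mk a b h)⁻¹ : SU2).1 = star (quaternionMatrix a b) := rfl
  unfold su2Angle
  rw [h1, star_quaternionMatrix]
  simp [mk, quaternionMatrix, Matrix.trace_fin_two]

theorem half_trace_mul_inv (a b c d : ℂ) (h h') :
    1 / 2 * (Matrix.trace ((mk a b h * (mk c d h')⁻¹ : SU2) : Matrix (Fin 2) (Fin 2) ℂ)).re =
      a.re * c.re + a.im * c.im + (b.re * d.re + b.im * d.im) := by
  have h1 : ((mk a b h * (mk c d h')⁻¹ : SU2) : Matrix (Fin 2) (Fin 2) ℂ) =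
      quaternionMatrix a b * star (quaternionMatrix c d) := rfl
  rw [h1, star_quaternionMatrix, quaternionMatrix_mul]
  simp [quaternionMatrix, Matrix.trace_fin_two]
  ring

theorem sq_add_sq_eq_one {a b : ℂ} (h : a * conj a + b * conj b = 1) :
    a.re ^ 2 + a.im ^ 2 + (b.re ^ 2 + b.im ^ 2) = 1 := by
  have := congrArg Complex.re h
  simp at this
  linarith

/-- The unit vector in `ℝ⁴` corresponding to an element of `SU(2)`. -/
noncomputable def vector (A : SU2) : EuclideanSpace ℝ (Fin 4) :=
  !₂[(A.1 0 0).re, (A.1 0 0).im, (A.1 0 1).re, (A.1 0 1).im]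

theorem norm_vector (A : SU2) : ‖vector A‖ = 1 := by
  obtain ⟨a, b, h, rfl⟩ := exists_eq_mk A
  rw [EuclideanSpace.norm_eq, Real.sqrt_eq_one]
  have := sq_add_sq_eq_one h
  simp [vector, mk, quaternionMatrix, Fin.sum_univ_four]
  linarith

/-- Half the trace of `A * B⁻¹` is the inner product of the unit quaternions `A` and `B`. -/
theorem su2Angle_mul_inv (A B : SU2) :
    su2Angle (A * B⁻¹) = 1 / Real.pi * InnerProductGeometry.angle (vector A) (vector B) := by
  rw [InnerProductGeometry.angle, norm_vector, norm_vector]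
  obtain ⟨a, b, h, rfl⟩ := exists_eq_mk A
  obtain ⟨c, d, h', rfl⟩ := exists_eq_mk B
  unfold su2Angle
  rw [half_trace_mul_inv]
  congr 2
  simp [vector, mk, quaternionMatrix, PiLp.inner_apply, Fin.sum_univ_four]
  ring

theorem su2Angle_mk (a b : ℂ) (h) : su2Angle (mk a b h) = 1 / Real.pi * Real.arccos a.re := by
  unfold su2Angle
  congr 2
  simp [mk, quaternionMatrix, Matrix.trace_fin_two]
  ring

theorem exists_conj_of_intertwine {a b c d : ℂ} (h h') (e f : ℂ) (hne : e ≠ 0 ∨ f ≠ 0)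
    (h1 : a * e - b * conj f = e * c - f * conj d) (h2 : a * f + b * conj e = e * d + f * conj c) :
    ∃ g : SU2, mk a b h * g = g * mk c d h' := by
  set r : ℝ := √(Complex.normSq e + Complex.normSq f)
  have hpos : 0 < Complex.normSq e + Complex.normSq f := by
    rcases hne with h | h
    · exact add_pos_of_pos_of_nonneg (Complex.normSq_pos.mpr h) (Complex.normSq_nonneg _)
    · exact add_pos_of_nonneg_of_pos (Complex.normSq_nonneg _) (Complex.normSq_pos.mpr h)
  have hr : (r : ℂ) * r = e * conj e + f * conj f := by
    rw [Complex.mul_conj, Complex.mul_conj, ← Complex.ofReal_mul, Real.mul_self_sqrt hpos.le,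
      Complex.ofReal_add]
  have hr0 : (r : ℂ) ≠ 0 := Complex.ofReal_ne_zero.mpr (Real.sqrt_pos.mpr hpos).ne'
  refine ⟨mk (e / r) (f / r) ?_, Subtype.ext ?_⟩
  · simp only [map_div₀, Complex.conj_ofReal]
    field_simp
    rw [← hr]
    ring
  · change quaternionMatrix _ _ * quaternionMatrix _ _ =
      quaternionMatrix _ _ * quaternionMatrix _ _
    rw [quaternionMatrix_mul, quaternionMatrix_mul]
    simp only [map_div₀, Complex.conj_ofReal]
    congr 1
    · field_simp
      linear_combination h1
    · field_simp
      linear_combination h2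

/-- Let `A`, `B` be the two quaternions, with common trace `t`. By Cayley–Hamilton, `q = A x - x
B⁻¹` satisfies `A q - q B = (A² - t A + 1) x = 0` for every quaternion `x`. The three cases take `x
= 1, i, j`, and a nonzero `q` is normalised by `exists_conj_of_intertwine`. If all three vanish,
then `A = B`. -/
theorem exists_conj_of_re_eq {a b c d : ℂ} (h h') (hre : a.re = c.re) :
    ∃ g : SU2, mk a b h * g = g * mk c d h' := by
  have ht : a + conj a = c + conj c := by rw [Complex.add_conj, Complex.add_conj, hre]
  by_cases h1 : a - conj c ≠ 0 ∨ b + d ≠ 0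
  · refine exists_conj_of_intertwine h h' _ _ h1 ?_ ?_
    · simp only [map_add]
      linear_combination h' - h + a * ht
    · simp only [map_sub, Complex.conj_conj]
      linear_combination b * ht
  by_cases h2 : Complex.I * (a - conj c) ≠ 0 ∨ Complex.I * (d - b) ≠ 0
  · refine exists_conj_of_intertwine h h' _ _ h2 ?_ ?_
    · simp only [map_mul, map_sub, Complex.conj_I]
      linear_combination Complex.I * (h' - h + a * ht)
    · simp only [map_mul, map_sub, Complex.conj_conj, Complex.conj_I]
      linear_combination -Complex.I * b * ht
  by_cases h3 : -b - conj d ≠ 0 ∨ a - c ≠ 0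
  · refine exists_conj_of_intertwine h h' _ _ h3 ?_ ?_
    · simp only [map_sub]
      linear_combination -b * ht
    · simp only [map_neg, map_sub, Complex.conj_conj]
      linear_combination h' - h + a * ht
  push Not at h1 h2 h3
  have hb : b = 0 := by
    have h4 : d - b = 0 := by simpa using h2.2
    linear_combination (h1.2 - h4) / 2
  have hd : d = 0 := by linear_combination h1.2 - hb
  have ha : a = c := sub_eq_zero.mp h3.2
  refine ⟨1, ?_⟩
  subst hb hd ha
  simp

theorem exists_conj_of_su2Angle_eq (A B : SU2) (h : su2Angle A = su2Angle B) :
    ∃ g : SU2, A * g = g * B := by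
  obtain ⟨a, b, hA, rfl⟩ := exists_eq_mk A
  obtain ⟨c, d, hB, rfl⟩ := exists_eq_mk B
  rw [su2Angle_mk, su2Angle_mk] at h
  have h1 := sq_add_sq_eq_one hA
  have h2 := sq_add_sq_eq_one hB
  refine exists_conj_of_re_eq hA hB (Real.arccos_injOn ?_ ?_ ?_)
  · constructor <;> nlinarith
  · constructor <;> nlinarith
  · exact mul_left_cancel₀ (by positivity) h

end SU2

/-! ### The tetrahedron -/

theorem mem_tetrahedron_iff (t : Fin 3 → ℝ) :
    t ∈ tetrahedron ↔ t 0 ≤ t 1 + t 2 ∧ t 1 ≤ t 0 + t 2 ∧ t 2 ≤ t 0 + t 1 ∧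
      t 0 + t 1 + t 2 ≤ 2 := by
  constructor
  · intro h
    have hc : Convex ℝ {t : Fin 3 → ℝ | t 0 ≤ t 1 + t 2 ∧ t 1 ≤ t 0 + t 2 ∧ t 2 ≤ t 0 + t 1 ∧
        t 0 + t 1 + t 2 ≤ 2} := by
      rintro x ⟨h1, h2, h3, h4⟩ y ⟨h1', h2', h3', h4'⟩ a b ha hb hab
      simp only [Set.mem_ofPred_eq, Pi.add_apply, Pi.smul_apply, smul_eq_mul]
      obtain rfl : b = 1 - a := by linarith
      refine ⟨?_, ?_, ?_, ?_⟩ <;> nlinarith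
    refine convexHull_min ?_ hc h
    rintro x (rfl | rfl | rfl | rfl) <;> norm_num [Matrix.cons_val_two]
  · rintro ⟨h0, h1, h2, h3⟩
    set P : Fin 4 → Fin 3 → ℝ := ![![0, 0, 0], ![0, 1, 1], ![1, 0, 1], ![1, 1, 0]]
    -- The barycentric coordinates are half the slacks of the four inequalities.
    set w : Fin 4 → ℝ := ![1 - (t 0 + t 1 + t 2) / 2, (t 1 + t 2 - t 0) / 2,
      (t 0 + t 2 - t 1) / 2, (t 0 + t 1 - t 2) / 2]
    have ht : t = ∑ i, w i • P i := by
      ext k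
      fin_cases k <;> simp [P, w, Fin.sum_univ_four] <;> ring
    rw [ht]
    refine (convex_convexHull ℝ _).sum_mem ?_ ?_ ?_
    · intro i _
      fin_cases i <;> simp [w] <;> linarith
    · simp [w, Fin.sum_univ_four]
      ring
    · intro i _
      apply subset_convexHull
      fin_cases i <;> simp [P]

theorem su2Angle_mem_tetrahedron (d : Fin 3 → SU2) :
    (fun k => su2Angle (d (k + 2) * (d k)⁻¹)) ∈ tetrahedron := by
  have hpi := Real.pi_pos
  rw [mem_tetrahedron_iff]
  simp only [SU2.su2Angle_mul_inv]
  change 1 / Real.pi * InnerProductGeometry.angle (SU2.vector (d 2)) (SU2.vector (d 0)) ≤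
    1 / Real.pi * InnerProductGeometry.angle (SU2.vector (d 0)) (SU2.vector (d 1)) +
    1 / Real.pi * InnerProductGeometry.angle (SU2.vector (d 1)) (SU2.vector (d 2)) ∧
    1 / Real.pi * InnerProductGeometry.angle (SU2.vector (d 0)) (SU2.vector (d 1)) ≤
    1 / Real.pi * InnerProductGeometry.angle (SU2.vector (d 2)) (SU2.vector (d 0)) +
    1 / Real.pi * InnerProductGeometry.angle (SU2.vector (d 1)) (SU2.vector (d 2)) ∧
    1 / Real.pi * InnerProductGeometry.angle (SU2.vector (d 1)) (SU2.vector (d 2)) ≤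
    1 / Real.pi * InnerProductGeometry.angle (SU2.vector (d 2)) (SU2.vector (d 0)) +
    1 / Real.pi * InnerProductGeometry.angle (SU2.vector (d 0)) (SU2.vector (d 1)) ∧
    1 / Real.pi * InnerProductGeometry.angle (SU2.vector (d 2)) (SU2.vector (d 0)) +
    1 / Real.pi * InnerProductGeometry.angle (SU2.vector (d 0)) (SU2.vector (d 1)) +
    1 / Real.pi * InnerProductGeometry.angle (SU2.vector (d 1)) (SU2.vector (d 2)) ≤ 2
  generalize SU2.vector (d 0) = x
  generalize SU2.vector (d 1) = y
  generalize SU2.vector (d 2) = z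
  have h1 := InnerProductGeometry.angle_le_angle_add_angle z y x
  have h2 := InnerProductGeometry.angle_le_angle_add_angle x z y
  have h3 := InnerProductGeometry.angle_le_angle_add_angle y x z
  -- The triangle inequality through the antipode of `x` bounds the perimeter by `2π`.
  have h4 := InnerProductGeometry.angle_le_angle_add_angle y (-x) z
  rw [InnerProductGeometry.angle_neg_right, InnerProductGeometry.angle_neg_left] at h4
  rw [InnerProductGeometry.angle_comm z y, InnerProductGeometry.angle_comm y x] at h1
  rw [InnerProductGeometry.angle_comm x z, InnerProductGeometry.angle_comm z y] at h2
  rw [InnerProductGeometry.angle_comm y x, InnerProductGeometry.angle_comm x z] at h3 h4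
  refine ⟨?_, ?_, ?_, ?_⟩
  · rw [← mul_add]
    exact mul_le_mul_of_nonneg_left (by linarith) (by positivity)
  · rw [← mul_add]
    exact mul_le_mul_of_nonneg_left (by linarith) (by positivity)
  · rw [← mul_add]
    exact mul_le_mul_of_nonneg_left (by linarith) (by positivity)
  · rw [← mul_add, ← mul_add, one_div, inv_mul_le_iff₀ hpi]
    linarith

/-- This solves the spherical law of cosines for the angle between the sides `α` and `β`. The
inequalities place `cos γ` between `cos (α + β)` and `cos (α - β)`, which is the range of the left
side. If `sin α * sin β = 0`, this range is a single point and any `c` would do. -/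
theorem exists_cos_sin_eq {α β γ : ℝ} (h1 : α ≤ β + γ) (h2 : β ≤ α + γ) (h3 : γ ≤ α + β)
    (h4 : α + β + γ ≤ 2 * Real.pi) :
    ∃ c s : ℝ, c ^ 2 + s ^ 2 = 1 ∧
      Real.cos α * Real.cos β + Real.sin α * Real.sin β * c = Real.cos γ := by
  have hα : 0 ≤ Real.sin α := Real.sin_nonneg_of_nonneg_of_le_pi (by linarith) (by linarith)
  have hβ : 0 ≤ Real.sin β := Real.sin_nonneg_of_nonneg_of_le_pi (by linarith) (by linarith)
  have hsub : Real.cos γ ≤ Real.cos (α - β) := by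
    rw [← Real.cos_abs (α - β)]
    exact Real.cos_le_cos_of_nonneg_of_le_pi (abs_nonneg _) (by linarith)
      (abs_le.mpr ⟨by linarith, by linarith⟩)
  have hadd : Real.cos (α + β) ≤ Real.cos γ := by
    rcases le_total (α + β) Real.pi with h | h
    · exact Real.cos_le_cos_of_nonneg_of_le_pi (by linarith) h h3
    · rw [← Real.cos_two_pi_sub (α + β)]
      exact Real.cos_le_cos_of_nonneg_of_le_pi (by linarith) (by linarith) (by linarith)
  rw [Real.cos_sub] at hsub
  rw [Real.cos_add] at hadd
  rcases (mul_nonneg hα hβ).eq_or_lt with h0 | h0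
  · exact ⟨1, 0, by norm_num, by rw [← h0] at hsub hadd ⊢; linarith⟩
  · set c := (Real.cos γ - Real.cos α * Real.cos β) / (Real.sin α * Real.sin β)
    have hc : Real.sin α * Real.sin β * c = Real.cos γ - Real.cos α * Real.cos β :=
      mul_div_cancel₀ _ h0.ne'
    have hc1 : c ≤ 1 := by
      rw [div_le_one h0]
      linarith
    have hc2 : -1 ≤ c := by
      rw [le_div_iff₀ h0]
      linarith
    refine ⟨c, √(1 - c ^ 2), ?_, by linarith⟩
    rw [Real.sq_sqrt (by nlinarith)]
    ring

theorem exists_su2Angle_eq (t : Fin 3 → ℝ) (ht : t ∈ tetrahedron) :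
    ∃ s : Fin 3 → SU2, ∀ k, su2Angle (s (k + 2) * (s k)⁻¹) = t k := by
  rw [mem_tetrahedron_iff] at ht
  obtain ⟨h0, h1, h2, h3⟩ := ht
  have hpi := Real.pi_pos
  obtain ⟨c, s, hcs, hγ⟩ := exists_cos_sin_eq (α := Real.pi * t 0) (β := Real.pi * t 1)
    (γ := Real.pi * t 2) (by nlinarith) (by nlinarith) (by nlinarith) (by nlinarith)
  have arccos : ∀ x : ℝ, 0 ≤ x → x ≤ 1 →
      1 / Real.pi * Real.arccos (Real.cos (Real.pi * x)) = x := by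
    intro x hx hx'
    rw [Real.arccos_cos (by positivity) (by nlinarith)]
    field_simp
  have e0 : (1 : ℂ) * conj 1 + 0 * conj 0 = 1 := by simp
  have e2 : (⟨Real.cos (Real.pi * t 0), Real.sin (Real.pi * t 0)⟩ : ℂ) *
      conj ⟨Real.cos (Real.pi * t 0), Real.sin (Real.pi * t 0)⟩ + 0 * conj 0 = 1 := by
    apply Complex.ext
    · simp
      nlinarith [Real.sin_sq_add_cos_sq (Real.pi * t 0)]
    · simp
      ring
  have e1 : (⟨Real.cos (Real.pi * t 1), Real.sin (Real.pi * t 1) * c⟩ : ℂ) *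
      conj ⟨Real.cos (Real.pi * t 1), Real.sin (Real.pi * t 1) * c⟩ +
      ⟨Real.sin (Real.pi * t 1) * s, 0⟩ * conj ⟨Real.sin (Real.pi * t 1) * s, 0⟩ = 1 := by
    apply Complex.ext
    · simp
      linear_combination Real.sin_sq_add_cos_sq (Real.pi * t 1) +
        Real.sin (Real.pi * t 1) ^ 2 * hcs
    · simp
      ring
  -- A spherical triangle: `s 0` is the identity, `s 2` lies at distance `π t₀` on a fixed great
  -- circle, and `s 1` at distance `π t₁` in a direction whose angle to that circle has cosine `c`.
  -- The third side then has length `π t₂` by `hγ`.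
  refine ⟨![SU2.mk _ _ e0, SU2.mk _ _ e1, SU2.mk _ _ e2], fun k => ?_⟩
  unfold su2Angle
  fin_cases k
  · change 1 / Real.pi * Real.arccos (1 / 2 * (Matrix.trace
      ((SU2.mk _ _ e2 * (SU2.mk _ _ e0)⁻¹ : SU2) : Matrix (Fin 2) (Fin 2) ℂ)).re) = t 0
    rw [SU2.half_trace_mul_inv]
    simpa using arccos (t 0) (by linarith) (by linarith)
  · change 1 / Real.pi * Real.arccos (1 / 2 * (Matrix.trace
      ((SU2.mk _ _ e0 * (SU2.mk _ _ e1)⁻¹ : SU2) : Matrix (Fin 2) (Fin 2) ℂ)).re) = t 1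
    rw [SU2.half_trace_mul_inv]
    simpa using arccos (t 1) (by linarith) (by linarith)
  · change 1 / Real.pi * Real.arccos (1 / 2 * (Matrix.trace
      ((SU2.mk _ _ e1 * (SU2.mk _ _ e2)⁻¹ : SU2) : Matrix (Fin 2) (Fin 2) ℂ)).re) = t 2
    rw [SU2.half_trace_mul_inv, ← arccos (t 2) (by linarith) (by linarith), ← hγ]
    congr 2
    simp
    ring

/-! ### The image of the moment maps -/

-- Inversion in `SU(2)` preserves the trace. Hence the value on an edge does not depend on the end
-- from which its meridian is read.
open CategoryTheory in
theorem goldman_eq_of_reverse {X : Type} [TopologicalSpace X] [PathConnectedSpace X] (x : X)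
    {p q : X} (C : Path p p) (C' : Path q q) (h : ∀ t, C' t = C (unitInterval.symm t))
    (c : ClRep (FundamentalGroup X x)) : goldman x C' c = goldman x C c := by
  obtain rfl : q = p := by simpa using h 0
  obtain rfl : C' = C.symm := by
    ext t
    exact h t
  obtain ⟨ρ⟩ := c
  change su2Angle (ρ (loopClass x C.symm)) = su2Angle (ρ (loopClass x C))
  have e : loopClass x C.symm = (loopClass x C)⁻¹ := by
    let a : FundamentalGroupoid.mk x ⟶ FundamentalGroupoid.mk q :=
      Path.Homotopic.Quotient.mk (PathConnectedSpace.somePath x q)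
    let l : FundamentalGroupoid.mk q ⟶ FundamentalGroupoid.mk q := Path.Homotopic.Quotient.mk C
    change (a ≫ Groupoid.inv l) ≫ Groupoid.inv a = Groupoid.inv ((a ≫ l) ≫ Groupoid.inv a)
    simp [Groupoid.inv_eq_inv]
  rw [e, map_inv, SU2.su2Angle_inv]

namespace TrivalentGraph

variable {V : Type} (Γ : TrivalentGraph V)

theorem meridian_opp_apply (h : V × Fin 3) (t : unitInterval) :
    Γ.meridian (Γ.opp h) t = Γ.meridian h (unitInterval.symm t) := by
  change Γ.trinion _ (trinionBoundary _ (Circle.exp _)) =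
    Γ.trinion _ (trinionBoundary _ (Circle.exp _))
  have hg := Quot.sound (Glue.glue (Γ := Γ) h (Circle.exp (2 * Real.pi * (1 - (t : ℝ)))))
  rw [unitInterval.coe_symm_eq]
  refine Eq.trans ?_ hg.symm
  have e : (Circle.exp (2 * Real.pi * (1 - (t : ℝ))))⁻¹ = Circle.exp (2 * Real.pi * t) := by
    rw [← Circle.exp_neg, ← Circle.periodic_exp]
    congr 1
    ring
  rw [e]
  rfl

theorem exists_gluingData (color : V → Bool) (color_opp : ∀ h, color (Γ.opp h).1 = !color h.1)
    (opp_snd : ∀ h, (Γ.opp h).2 = h.2) (t : V → Fin 3 → ℝ) (ht : ∀ v, t v ∈ tetrahedron)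
    (ht' : ∀ h, t (Γ.opp h).1 h.2 = t h.1 h.2) :
    ∃ D : GluingData Γ SU2, ∀ v k, su2Angle (D.s v (k + 2) * (D.s v k)⁻¹) = t v k := by
  choose s hs using fun v => exists_su2Angle_eq (t v) (ht v)
  have hg : ∀ h : V × Fin 3, ∃ g : SU2, s h.1 (h.2 + 2) * (s h.1 h.2)⁻¹ * g =
      g * (s (Γ.opp h).1 (h.2 + 2) * (s (Γ.opp h).1 h.2)⁻¹) := fun h =>
    SU2.exists_conj_of_su2Angle_eq _ _ (by rw [hs, hs, ht'])
  choose g hg using hg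
  -- The conjugators chosen for the two halves of an edge need not be inverse to each other, so only
  -- the one at the end of colour `false` is used.
  refine ⟨⟨color, color_opp, opp_snd, s, fun h => if color h.1 then (g (Γ.opp h))⁻¹ else g h,
    fun h => ?_, fun h => ?_⟩, hs⟩
  · rw [color_opp, Γ.opp_opp]
    cases color h.1 <;> simp
  · have key : s h.1 (h.2 + 2) * (s h.1 h.2)⁻¹ * (if color h.1 then (g (Γ.opp h))⁻¹ else g h) =
        (if color h.1 then (g (Γ.opp h))⁻¹ else g h) *
          (s (Γ.opp h).1 (h.2 + 2) * (s (Γ.opp h).1 h.2)⁻¹) := by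
      cases color h.1
      · simpa using hg h
      · have h1 := hg (Γ.opp h)
        rw [Γ.opp_opp, opp_snd] at h1
        simp only [if_true]
        rw [eq_inv_mul_iff_mul_eq, ← mul_assoc, ← h1]
        group
    generalize (if color h.1 then (g (Γ.opp h))⁻¹ else g h) = u at key ⊢
    calc (s h.1 h.2)⁻¹ * u * s (Γ.opp h).1 h.2
        = (s h.1 (h.2 + 2))⁻¹ * (s h.1 (h.2 + 2) * (s h.1 h.2)⁻¹ * u) * s (Γ.opp h).1 h.2 := by
          group
      _ = _ := by
          rw [key]
          group

variable [PathConnectedSpace Γ.Surface] (x : Γ.Surface)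

theorem goldman_meridian_opp (h : V × Fin 3) (c : ClRep (FundamentalGroup Γ.Surface x)) :
    goldman x (Γ.meridian (Γ.opp h)) c = goldman x (Γ.meridian h) c :=
  goldman_eq_of_reverse x _ _ (Γ.meridian_opp_apply h) c

theorem goldman_meridian_mem_tetrahedron (v : V) (c : ClRep (FundamentalGroup Γ.Surface x)) :
    (fun k => goldman x (Γ.meridian (v, k)) c) ∈ tetrahedron := by
  obtain ⟨ρ⟩ := c
  obtain ⟨d, hd⟩ := Γ.exists_holonomy_meridian ρ v
  convert! su2Angle_mem_tetrahedron d using 2 with k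
  obtain ⟨g, hg⟩ := hd k
  change su2Angle (ρ (loopClass x (Γ.meridian (v, k)))) = _
  rw [← SU2.su2Angle_inv, ← holonomy_loop, hg, su2Angle_conj]

theorem exists_goldman_eq (color : V → Bool) (color_opp : ∀ h, color (Γ.opp h).1 = !color h.1)
    (opp_snd : ∀ h, (Γ.opp h).2 = h.2) (t : V → Fin 3 → ℝ) (ht : ∀ v, t v ∈ tetrahedron)
    (ht' : ∀ h, t (Γ.opp h).1 h.2 = t h.1 h.2) :
    ∃ c : ClRep (FundamentalGroup Γ.Surface x),
      ∀ v k, goldman x (Γ.meridian (v, k)) c = t v k := by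
  obtain ⟨D, hD⟩ := Γ.exists_gluingData color color_opp opp_snd t ht ht'
  obtain ⟨ρ, hρ⟩ := D.exists_representation x
  refine ⟨Quotient.mk _ ρ, fun v k => ?_⟩
  obtain ⟨a, g, hg, h⟩ := hρ (v, k) (PathConnectedSpace.somePath x _)
  rw [goldman_mk x _ (PathConnectedSpace.somePath x _), h, su2Angle_conj, SU2.su2Angle_inv, ← hD v k]
  rcases hg with rfl | rfl
  · rfl
  · rw [← SU2.su2Angle_inv]
    congr 1
    group

end TrivalentGraph

theorem range_momentMapTheta (x : thetaGraph.Surface) :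
    Set.range (momentMapTheta x) = tetrahedron := by
  ext t
  constructor
  · rintro ⟨c, rfl⟩
    exact thetaGraph.goldman_meridian_mem_tetrahedron x false c
  · intro ht
    obtain ⟨c, hc⟩ := thetaGraph.exists_goldman_eq x id (fun _ => rfl) (fun _ => rfl)
      (fun _ => t) (fun _ => ht) (fun _ => rfl)
    exact ⟨c, funext fun k => hc false k⟩

theorem mem_swapThird_image_iff (S : Set ((Fin 3 → ℝ) × (Fin 3 → ℝ)))
    (t : (Fin 3 → ℝ) × (Fin 3 → ℝ)) : t ∈ swapThird '' S ↔ swapThird t ∈ S := by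
  have h : ∀ t, swapThird (swapThird t) = t := by
    intro t
    unfold swapThird
    refine Prod.ext (funext fun i => ?_) (funext fun i => ?_) <;> fin_cases i <;> rfl
  constructor
  · rintro ⟨s, hs, rfl⟩
    rwa [h]
  · exact fun ht => ⟨_, ht, h t⟩

theorem range_momentMapThreeTheta (x : threeThetaGraph.Surface) :
    Set.range (momentMapThreeTheta x) =
      (tetrahedron ×ˢ tetrahedron) ∩ (swapThird '' (tetrahedron ×ˢ tetrahedron)) := by
  ext t
  rw [Set.mem_inter_iff, mem_swapThird_image_iff]
  constructor
  · rintro ⟨c, rfl⟩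
    have hm := fun v => threeThetaGraph.goldman_meridian_mem_tetrahedron x v c
    have ho := fun h => threeThetaGraph.goldman_meridian_opp x h c
    -- The upper right and lower left vertices have the same string and top or bottom arc as the
    -- vertices just used, but the other side of the oval: their triples are the components of
    -- `swapThird`.
    refine ⟨⟨hm (0, false), hm (1, true)⟩, ?_, ?_⟩
    · convert! hm (0, true) using 1
      funext k
      fin_cases k
      · exact ho ((0, true), 0)
      · exact ho ((0, true), 1)
      · exact ho ((0, true), 2)
    · convert! hm (1, false) using 1
      funext k
      fin_cases k
      · exact ho ((1, false), 0)
      · exact ho ((1, false), 1)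
      · exact ho ((1, false), 2)
  · rintro ⟨⟨h1, h2⟩, h3, h4⟩
    let T : Fin 2 × Bool → Fin 3 → ℝ := fun v =>
      if v.1 = 0 then (if v.2 then (swapThird t).1 else t.1)
      else (if v.2 then t.2 else (swapThird t).2)
    -- Every edge changes exactly one of the two labels of a vertex, so the parity of the labels is
    -- a proper two-colouring.
    obtain ⟨c, hc⟩ := threeThetaGraph.exists_goldman_eq x (fun v => xor (v.1 = 1) v.2)
      (by decide) (by decide) T (by
        rintro ⟨i, b⟩
        fin_cases i <;> cases b
        exacts [h1, h3, h4, h2]) (by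
        rintro ⟨⟨i, b⟩, k⟩
        fin_cases i <;> cases b <;> fin_cases k <;> rfl)
    exact ⟨c, Prod.ext (funext fun k => hc (0, false) k) (funext fun k => hc (1, true) k)⟩

theorem mainTheorem2 :
    (∀ x : thetaGraph.Surface, Set.range (momentMapTheta x) = tetrahedron) ∧
    (∀ x : threeThetaGraph.Surface, Set.range (momentMapThreeTheta x) =
      (tetrahedron ×ˢ tetrahedron) ∩ (swapThird '' (tetrahedron ×ˢ tetrahedron))) :=
  ⟨range_momentMapTheta, range_momentMapThreeTheta⟩
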